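/- A plane partition of a non-negative integer $n$ is an array $(a_{i,j})_{i,j\ge 1}$ of non-negative integers, only finitely many of them non-zero, with $a_{i,j}\ge a_{i,j+1}$ and $a_{i,j}\ge a_{i+1,j}$ for all $i,j$, and $\sum_{i,j}a_{i,j}=n$. Let $PL(n)$ denote the number of plane partitions of $n$ (so $PL(0)=1$ and $PL(3)=6$). For a positive integer $N$ and real $s$ let $\zeta_N(s)=\sum_{n=1}^{N} n^{-s}$, and for $u>0$ and real $z$ let $$\psi^0_u(z)=\sum_{n=0}^{\infty}\frac{z^n}{n!\,\Gamma(nu+1)}.$$ Then for all positive integers $N$, $$e^{-1}N^{-1}\,\psi^0_2\bigl(\zeta_N(3)N^2\bigr)\,\bigl(\psi^0_1(\zeta_N(2)N)\bigr)^{-1}\;\le\;\sum_{n=0}^{N}PL(n)\;\le\;\psi^0_2\bigl(\zeta_N(3)N^2\bigr)\,\psi^0_1\bigl(\zeta_N(2)N\bigr).$$ -/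

import Mathlib

open scoped Nat

/-- A plane partition of `n`: an array `a (i, j)` (`i, j ≥ 0`) of natural numbers, all but finitely
many of them zero, weakly decreasing along every row and down every column, with total sum `n`.
The positions of the zero entries are the empty cells of the diagram. -/
def IsPlanePartition (n : ℕ) (a : ℕ × ℕ →₀ ℕ) : Prop :=
  (∀ i j, a (i, j + 1) ≤ a (i, j)) ∧ (∀ i j, a (i + 1, j) ≤ a (i, j)) ∧
    (a.sum fun _ m => m) = n

/-- The number of plane partitions of `n`. -/
noncomputable def PL (n : ℕ) : ℕ := {a : ℕ × ℕ →₀ ℕ | IsPlanePartition n a}.ncard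

/-- There are finitely many plane partitions of `n`, so the cardinality above is a genuine one. -/
theorem finite_isPlanePartition (n : ℕ) : {a : ℕ × ℕ →₀ ℕ | IsPlanePartition n a}.Finite := by
  refine ((Finset.range n ×ˢ Finset.range n).finsuppAntidiag n).finite_toSet.subset ?_
  rintro a ⟨hr, hc, hs⟩
  have key : ∀ s : Finset (ℕ × ℕ), (∀ p ∈ s, a p ≠ 0) → s.card ≤ n := by
    intro s h
    have h1 : s ⊆ a.support := fun p hp => Finsupp.mem_support_iff.2 (h p hp)
    calc s.card ≤ a.support.card := Finset.card_le_card h1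
      _ = ∑ p ∈ a.support, 1 := by simp
      _ ≤ ∑ p ∈ a.support, a p := Finset.sum_le_sum fun p hp =>
          Nat.one_le_iff_ne_zero.2 (Finsupp.mem_support_iff.1 hp)
      _ = n := hs
  have hsub : a.support ⊆ Finset.range n ×ˢ Finset.range n := by
    rintro ⟨i, j⟩ hp
    have hp : a (i, j) ≠ 0 := Finsupp.mem_support_iff.1 hp
    have hcol : Antitone fun k => a (k, j) := antitone_nat_of_succ_le fun k => hc k j
    have hrow : Antitone fun k => a (i, k) := antitone_nat_of_succ_le fun k => hr i k
    have hi := key ((Finset.range (i + 1)).map ⟨fun k => (k, j), fun x y h => by simpa using h⟩) (by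
      simp only [Finset.mem_map, Finset.mem_range]
      rintro _ ⟨k, hk, rfl⟩
      exact fun h0 => hp (Nat.le_zero.1 (h0 ▸ hcol (Nat.lt_succ_iff.1 hk))))
    have hj := key ((Finset.range (j + 1)).map ⟨fun k => (i, k), fun x y h => by simpa using h⟩) (by
      simp only [Finset.mem_map, Finset.mem_range]
      rintro _ ⟨k, hk, rfl⟩
      exact fun h0 => hp (Nat.le_zero.1 (h0 ▸ hrow (Nat.lt_succ_iff.1 hk))))
    simp only [Finset.card_map, Finset.card_range] at hi hj
    simp only [Finset.mem_product, Finset.mem_range]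
    omega
  rw [Finset.mem_coe, Finset.mem_finsuppAntidiag]
  refine ⟨?_, hsub⟩
  exact (Finset.sum_subset hsub fun p _ hp => by simpa using hp).symm.trans hs

/-- The truncated zeta function `ζ_N(s) = ∑_{n=1}^{N} n^{-s}`. -/
noncomputable def truncZeta (N : ℕ) (s : ℝ) : ℝ := ∑ n ∈ Finset.Icc 1 N, 1 / (n : ℝ) ^ s

/-- The function `ψ^v_u(z) = ∑_{n ≥ 0} z^n / (n! Γ(n u + v + 1))`. -/
noncomputable def psi (v u z : ℝ) : ℝ := ∑' n : ℕ, z ^ n / (n ! * Real.Gamma (n * u + v + 1))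

/-- The series defining `ψ^0_u` converges for all natural numbers `u`. -/
theorem summable_psi_zero (u : ℕ) (z : ℝ) :
    Summable fun n : ℕ => z ^ n / (n ! * Real.Gamma (n * u + 0 + 1)) := by
  refine Summable.of_norm_bounded (Real.summable_pow_div_factorial |z|) fun n => ?_
  have h : Real.Gamma (n * u + 0 + 1) = ((n * u)! : ℕ) := by
    rw [← Real.Gamma_nat_eq_factorial]; push_cast; simp
  have h1 : (1 : ℝ) ≤ ((n * u)! : ℕ) := by
    exact_mod_cast Nat.one_le_iff_ne_zero.2 (Nat.factorial_ne_zero _)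
  have h2 : (0 : ℝ) < (n ! : ℕ) := by exact_mod_cast Nat.factorial_pos n
  rw [h, norm_div, norm_pow, Real.norm_eq_abs, norm_mul, Real.norm_natCast, Real.norm_natCast]
  gcongr
  nlinarith

/-! By MacMahon, `PL n` is the coefficient of `X ^ n` in `∏ 1 / (1 - X ^ (i + j + 1))`. Here this is
proved bijectively: a shape is dismantled corner by corner, each removal toggling one diagonal, and
diagonal sums of a monotone array turn into rectangle sums of an arbitrary filling
(`exists_perm_diagSum_eq_rectSum`).

Up to degree `N` the product is the exponential of `∑ X ^ m / (m (1 - X ^ m) ^ 2)`, `m ≤ N`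
(`coeff_macMahonProd_eq`). With `u = X ^ m / (1 - X ^ m)` and `v = 1 + u = 1 / (1 - X ^ m)`, the
`m`-th summand is `(u ^ 2 + u) / m`. Multiplying by `u` or `v` turns sums of coefficients into lower
or upper Riemann sums of step `m`, so a bound of order `M ^ r / r!` becomes one of order `M ^ (r +
1) / (m (r + 1)!)`. Hence powers of `∑ u ^ 2 / m` and `∑ v ^ 2 / m` are compared with `ζ_N(3)`,
those of `∑ u / m` with `ζ_N(2)`, and summing over the exponential series gives the values of `psi`.

For series with non-negative coefficients, the sum of coefficients of an exponential is
submultiplicative in the exponent (`coeffSum_truncExp_add_le`). The upper bound follows from `u ^ 2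
+ u`; the lower one from `v ^ 2 = (u ^ 2 + u) + u + 1`, where the constants add up to the harmonic
number and cost a factor at most `e N`. -/

/-! ### Diagonal toggles and monotone arrays -/

/-- The piecewise-linear toggle along the diagonal of the cell `(p, q)`: the cells strictly before
`(p, q)` on its diagonal are reflected between their neighbours, and `s` times the larger of the two
preceding neighbours is added at `(p, q)`. -/
def diagToggle (p q : ℕ) (s : ℤ) (f : ℕ → ℕ → ℤ) (i j : ℕ) : ℤ :=
  if i = p ∧ j = q then f i j + s * max (f (i - 1) j) (f i (j - 1))
  else if 1 ≤ i ∧ 1 ≤ j ∧ i < p ∧ i + q = j + p then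
    min (f (i + 1) j) (f i (j + 1)) + max (f (i - 1) j) (f i (j - 1)) - f i j
  else f i j

theorem diagToggle_corner (p q : ℕ) (s : ℤ) (f : ℕ → ℕ → ℤ) :
    diagToggle p q s f p q = f p q + s * max (f (p - 1) q) (f p (q - 1)) := by
  simp [diagToggle]

theorem diagToggle_diag {p q : ℕ} (s : ℤ) (f : ℕ → ℕ → ℤ) {i j : ℕ}
    (h : 1 ≤ i ∧ 1 ≤ j ∧ i < p ∧ i + q = j + p) : diagToggle p q s f i j =
      min (f (i + 1) j) (f i (j + 1)) + max (f (i - 1) j) (f i (j - 1)) - f i j := by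
  rw [diagToggle, if_neg (by omega), if_pos h]

theorem diagToggle_of_ne {p q : ℕ} (s : ℤ) (f : ℕ → ℕ → ℤ) {i j : ℕ} (h : i + q ≠ j + p) :
    diagToggle p q s f i j = f i j := by
  rw [diagToggle, if_neg (by omega), if_neg (by omega)]

theorem diagToggle_of_lt {p q : ℕ} (s : ℤ) (f : ℕ → ℕ → ℤ) {i j : ℕ} (h : p < i) :
    diagToggle p q s f i j = f i j := by
  rw [diagToggle, if_neg (by omega), if_neg (by omega)]

theorem diagToggle_row_zero {p q : ℕ} (hp : 1 ≤ p) (s : ℤ) (f : ℕ → ℕ → ℤ) (j : ℕ) :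
    diagToggle p q s f 0 j = f 0 j := by
  rw [diagToggle, if_neg (by omega), if_neg (by omega)]

theorem diagToggle_col_zero {p q : ℕ} (hq : 1 ≤ q) (s : ℤ) (f : ℕ → ℕ → ℤ) (i : ℕ) :
    diagToggle p q s f i 0 = f i 0 := by
  rw [diagToggle, if_neg (by omega), if_neg (by omega)]

/-- The neighbours entering each formula lie on the two adjacent diagonals, which the toggle leaves
fixed. So the reflections are involutions and the shift at the corner is undone by the opposite
sign. -/
theorem diagToggle_neg_diagToggle {p q : ℕ} (hp : 1 ≤ p) (hq : 1 ≤ q) (s : ℤ)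
    (f : ℕ → ℕ → ℤ) : diagToggle p q (-s) (diagToggle p q s f) = f := by
  funext i j
  by_cases h : i + q = j + p
  · rcases lt_trichotomy i p with hi | rfl | hi
    · by_cases h0 : 1 ≤ i ∧ 1 ≤ j
      · rw [diagToggle_diag _ _ ⟨h0.1, h0.2, hi, h⟩, diagToggle_diag _ f ⟨h0.1, h0.2, hi, h⟩,
          diagToggle_of_ne, diagToggle_of_ne, diagToggle_of_ne, diagToggle_of_ne]
        · ring
        all_goals omega
      · rcases Nat.eq_zero_or_pos i with rfl | hi'
        · rw [diagToggle_row_zero hp, diagToggle_row_zero hp]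
        · obtain rfl : j = 0 := by omega
          rw [diagToggle_col_zero hq, diagToggle_col_zero hq]
    · obtain rfl : j = q := by omega
      rw [diagToggle_corner, diagToggle_corner, diagToggle_of_ne, diagToggle_of_ne]
      · ring
      all_goals omega
    · rw [diagToggle_of_lt _ _ hi, diagToggle_of_lt _ _ hi]
  · rw [diagToggle_of_ne _ _ h, diagToggle_of_ne _ _ h]

/-- The toggle along the diagonal of a cell, as a permutation of all arrays. -/
def diagToggleEquiv (p q : ℕ) (hp : 1 ≤ p) (hq : 1 ≤ q) : Equiv.Perm (ℕ → ℕ → ℤ) where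
  toFun := diagToggle p q (-1)
  invFun := diagToggle p q 1
  left_inv f := by simpa using diagToggle_neg_diagToggle hp hq (-1) f
  right_inv f := diagToggle_neg_diagToggle hp hq 1 f

/-- A non-negative array, with zeros in row and column `0`, that is weakly increasing along rows and
columns on the set of cells `S`. -/
structure MonotoneOnCells (S : Finset (ℕ × ℕ)) (f : ℕ → ℕ → ℤ) : Prop where
  nonneg : ∀ i j, 0 ≤ f i j
  row_zero : ∀ j, f 0 j = 0
  col_zero : ∀ i, f i 0 = 0
  col_le : ∀ i j, (i, j) ∈ S → f (i - 1) j ≤ f i j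
  row_le : ∀ i j, (i, j) ∈ S → f i (j - 1) ≤ f i j

/-- A set of cells with positive coordinates that is closed downwards. -/
def IsShape (S : Finset (ℕ × ℕ)) : Prop :=
  (∀ i j, (i, j) ∈ S → 1 ≤ i ∧ 1 ≤ j) ∧
    ∀ i j i' j', (i, j) ∈ S → 1 ≤ i' → 1 ≤ j' → i' ≤ i → j' ≤ j → (i', j') ∈ S

theorem MonotoneOnCells.max_le {S : Finset (ℕ × ℕ)} {f : ℕ → ℕ → ℤ} (h : MonotoneOnCells S f)
    {i j : ℕ} (hS : (i, j) ∈ S) : max (f (i - 1) j) (f i (j - 1)) ≤ f i j :=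
  _root_.max_le (h.col_le _ _ hS) (h.row_le _ _ hS)

/-- Toggling along the diagonal of an outer corner `(p, q)` of `S` preserves monotonicity on `S`, as
soon as the new entry at `(p, q)` is non-negative. -/
theorem MonotoneOnCells.diagToggle {S : Finset (ℕ × ℕ)} {p q : ℕ} (hpq : (p, q) ∉ S)
    (hins : IsShape (insert (p, q) S)) (hS : IsShape S) {f : ℕ → ℕ → ℤ} (s : ℤ)
    (h : MonotoneOnCells S f) (h0 : 0 ≤ f p q + s * max (f (p - 1) q) (f p (q - 1)))  :
    MonotoneOnCells S (diagToggle p q s f) := by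
  obtain ⟨hp, hq⟩ := hins.1 p q (Finset.mem_insert_self _ _)
  have mem : ∀ i j, 1 ≤ i → 1 ≤ j → i ≤ p → j ≤ q → (i ≠ p ∨ j ≠ q) → (i, j) ∈ S := by
    intro i j h1 h2 h3 h4 h5
    have := hins.2 p q i j (Finset.mem_insert_self _ _) h1 h2 h3 h4
    rw [Finset.mem_insert, Prod.mk.injEq] at this
    rcases this with h | h
    · omega
    · exact h
  -- The old entry lies between the larger predecessor and the smaller successor; its reflection
  -- stays in that interval. All neighbours involved are in `S` because the cell lies strictly
  -- before the corner.
  have lower : ∀ i j, 1 ≤ i ∧ 1 ≤ j ∧ i < p ∧ i + q = j + p →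
      max (f (i - 1) j) (f i (j - 1)) ≤ _root_.diagToggle p q s f i j := by
    intro i j hd
    rw [diagToggle_diag _ _ hd]
    have h1 := h.col_le (i + 1) j (mem _ _ (by omega) (by omega) (by omega) (by omega) (by omega))
    have h2 := h.row_le i (j + 1) (mem _ _ (by omega) (by omega) (by omega) (by omega) (by omega))
    simp only [Nat.add_sub_cancel] at h1 h2
    have := le_min h1 h2
    linarith
  have upper : ∀ i j, 1 ≤ i ∧ 1 ≤ j ∧ i < p ∧ i + q = j + p →
      _root_.diagToggle p q s f i j ≤ min (f (i + 1) j) (f i (j + 1)) := by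
    intro i j hd
    rw [diagToggle_diag _ _ hd]
    have := h.max_le (mem i j (by omega) (by omega) (by omega) (by omega) (by omega))
    linarith
  have notin : ∀ i j, (i, j) ∈ S → ¬ (p ≤ i ∧ q ≤ j) := fun i j hij hle =>
    hpq (hS.2 i j p q hij hp hq hle.1 hle.2)
  have cases : ∀ i j, (i = p ∧ j = q) ∨ (1 ≤ i ∧ 1 ≤ j ∧ i < p ∧ i + q = j + p) ∨
      _root_.diagToggle p q s f i j = f i j := by
    intro i j
    rw [_root_.diagToggle]
    split_ifs <;> tauto
  refine ⟨fun i j => ?_, fun j => ?_, fun i => ?_, fun i j hij => ?_, fun i j hij => ?_⟩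
  · rcases cases i j with ⟨rfl, rfl⟩ | hd | he
    · rwa [diagToggle_corner]
    · exact (h.nonneg _ _).trans ((le_max_left _ _).trans (lower i j hd))
    · rw [he]; exact h.nonneg _ _
  · rw [diagToggle_row_zero hp]; exact h.row_zero j
  · rw [diagToggle_col_zero hq]; exact h.col_zero i
  · have hn := notin i j hij
    have hpos := hS.1 i j hij
    rcases cases i j with ⟨rfl, rfl⟩ | hd | he
    · omega
    · rw [diagToggle_of_ne s f (i := i - 1) (by omega)]
      exact (le_max_left _ _).trans (lower i j hd)
    · rcases cases (i - 1) j with ⟨h1, h2⟩ | hd | he'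
      · omega
      · have := (upper (i - 1) j hd).trans (min_le_left _ _)
        rw [he]
        rwa [Nat.sub_add_cancel hpos.1] at this
      · rw [he, he']; exact h.col_le i j hij
  · have hn := notin i j hij
    have hpos := hS.1 i j hij
    rcases cases i j with ⟨rfl, rfl⟩ | hd | he
    · omega
    · rw [diagToggle_of_ne s f (j := j - 1) (by omega)]
      exact (le_max_right _ _).trans (lower i j hd)
    · rcases cases i (j - 1) with ⟨h1, h2⟩ | hd | he'
      · omega
      · have := (upper i (j - 1) hd).trans (min_le_right _ _)
        rw [he]
        rwa [Nat.sub_add_cancel hpos.2] at this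
      · rw [he, he']; exact h.row_le i j hij

/-- The two inequalities at the new corner say exactly that its entry minus the larger predecessor
is non-negative, and that difference is the toggled entry. -/
theorem monotoneOnCells_insert_iff {S : Finset (ℕ × ℕ)} {p q : ℕ} (hpq : (p, q) ∉ S)
    (hins : IsShape (insert (p, q) S)) (hS : IsShape S) (hp : 1 ≤ p) (hq : 1 ≤ q)
    (f : ℕ → ℕ → ℤ) :
    MonotoneOnCells (insert (p, q) S) f ↔ MonotoneOnCells S (diagToggleEquiv p q hp hq f) := by
  constructor
  · intro h
    have h' : MonotoneOnCells S f := ⟨h.nonneg, h.row_zero, h.col_zero,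
      fun i j hij => h.col_le i j (Finset.mem_insert_of_mem hij),
      fun i j hij => h.row_le i j (Finset.mem_insert_of_mem hij)⟩
    refine h'.diagToggle hpq hins hS (-1) ?_
    have := h.max_le (Finset.mem_insert_self _ _)
    linarith
  · intro h
    obtain ⟨g, rfl⟩ := (diagToggleEquiv p q hp hq).symm.surjective f
    rw [Equiv.apply_symm_apply] at h
    have h0 : 0 ≤ max (g (p - 1) q) (g p (q - 1)) := (h.nonneg _ _).trans (le_max_left _ _)
    have h1 := h.nonneg p q
    have h' : MonotoneOnCells S (diagToggle p q 1 g) :=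
      h.diagToggle hpq hins hS 1 (by linarith)
    change MonotoneOnCells _ (diagToggle p q 1 g)
    refine ⟨h'.nonneg, h'.row_zero, h'.col_zero, fun i j hij => ?_, fun i j hij => ?_⟩
    · rw [Finset.mem_insert, Prod.mk.injEq] at hij
      rcases hij with ⟨rfl, rfl⟩ | hij
      · rw [diagToggle_corner, diagToggle_of_ne _ _ (by omega)]
        have := le_max_left (g (i - 1) j) (g i (j - 1))
        linarith
      · exact h'.col_le i j hij
    · rw [Finset.mem_insert, Prod.mk.injEq] at hij
      rcases hij with ⟨rfl, rfl⟩ | hij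
      · rw [diagToggle_corner, diagToggle_of_ne _ _ (by omega)]
        have := le_max_right (g (i - 1) j) (g i (j - 1))
        linarith
      · exact h'.row_le i j hij

/-! ### Diagonal sums and rectangle sums -/

/-- The sum of the entries on the diagonal of `(i, j)`, up to that cell. -/
def diagSum (f : ℕ → ℕ → ℤ) : ℕ → ℕ → ℤ
  | 0, _ => 0
  | _ + 1, 0 => 0
  | i + 1, j + 1 => diagSum f i j + f (i + 1) (j + 1)

theorem diagSum_zero_left (f : ℕ → ℕ → ℤ) (j : ℕ) : diagSum f 0 j = 0 := by
  rw [diagSum]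

theorem diagSum_zero_right (f : ℕ → ℕ → ℤ) (i : ℕ) : diagSum f i 0 = 0 := by
  cases i <;> rw [diagSum]

theorem diagSum_succ (f : ℕ → ℕ → ℤ) (i j : ℕ) :
    diagSum f (i + 1) (j + 1) = diagSum f i j + f (i + 1) (j + 1) := by
  rw [diagSum]

/-- The sum of the entries in the rectangle below `(i, j)`. -/
def rectSum (f : ℕ → ℕ → ℤ) (i j : ℕ) : ℤ :=
  ∑ a ∈ Finset.range i, ∑ b ∈ Finset.range j, f (a + 1) (b + 1)

theorem rectSum_succ (f : ℕ → ℕ → ℤ) (i j : ℕ) :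
    rectSum f (i + 1) (j + 1) =
      rectSum f i (j + 1) + rectSum f (i + 1) j - rectSum f i j + f (i + 1) (j + 1) := by
  simp only [rectSum, Finset.sum_range_succ, Finset.sum_add_distrib]
  ring

theorem diagSum_diagToggle_of_ne {p q : ℕ} (s : ℤ) (f : ℕ → ℕ → ℤ) :
    ∀ i j : ℕ, i + q ≠ j + p → diagSum (diagToggle p q s f) i j = diagSum f i j
  | 0, _, _ => by rw [diagSum_zero_left, diagSum_zero_left]
  | _ + 1, 0, _ => by rw [diagSum_zero_right, diagSum_zero_right]
  | i + 1, j + 1, h => by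
    rw [diagSum_succ, diagSum_succ, diagSum_diagToggle_of_ne s f i j (by omega),
      diagToggle_of_ne _ _ h]

/-- Old plus reflected entry is a `min` of successors plus a `max` of predecessors. The `max` of one
step pairs with the `min` of the step before it on the same two cells, and `min + max` is their sum,
so only the last `max` is left over. That is what the new corner entry subtracts, which makes
diagonal sums obey the recursion `rectSum_succ`. -/
theorem diagSum_diagToggle_add {p q : ℕ} (s : ℤ) {f : ℕ → ℕ → ℤ} (h0 : ∀ i j, 0 ≤ f i j)
    (hr : ∀ j, f 0 j = 0) (hc : ∀ i, f i 0 = 0) : ∀ i j : ℕ, i < p → i + q = j + p →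
    diagSum (diagToggle p q s f) i j + diagSum f i j =
      diagSum f i (j + 1) + diagSum f (i + 1) j - max (f i (j + 1)) (f (i + 1) j)
  | 0, 0, _, _ => by simp [diagSum_zero_left, diagSum_zero_right, hr, hc]
  | 0, j + 1, _, _ => by
    have := h0 1 (j + 1)
    simp [diagSum_zero_left, diagSum_succ, hr, this]
  | i + 1, 0, _, _ => by
    have := h0 (i + 1) 1
    simp [diagSum_zero_right, diagSum_succ, hc, this]
  | i + 1, j + 1, hi, h => by
    have ih := diagSum_diagToggle_add (p := p) (q := q) s h0 hr hc i j (by omega) (by omega)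
    have e := min_add_max (f (i + 1 + 1) (j + 1)) (f (i + 1) (j + 1 + 1))
    rw [diagSum_succ, diagSum_succ f i j, diagSum_succ f i (j + 1), diagSum_succ f (i + 1) j,
      diagToggle_diag _ _ ⟨by omega, by omega, hi, h⟩, max_comm (f (i + 1) (j + 1 + 1))]
    simp only [Nat.add_sub_cancel]
    linarith

/-- Reverse plane partitions of a given shape correspond bijectively to arbitrary fillings of the
shape, in such a way that diagonal sums become sums over rectangles. -/
theorem exists_perm_diagSum_eq_rectSum (S : Finset (ℕ × ℕ)) (hS : IsShape S) :
    ∃ Φ : Equiv.Perm (ℕ → ℕ → ℤ), (∀ f, MonotoneOnCells S f ↔ MonotoneOnCells ∅ (Φ f)) ∧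
      (∀ f i j, (i, j) ∉ S → Φ f i j = f i j) ∧
      ∀ f, MonotoneOnCells S f → ∀ i j, (i, j) ∈ S → (i + 1, j + 1) ∉ S →
        diagSum f i j = rectSum (Φ f) i j := by
  induction hn : S.card generalizing S with
  | zero =>
    obtain rfl := Finset.card_eq_zero.1 hn
    exact ⟨1, fun f => Iff.rfl, fun f i j _ => rfl, fun f _ i j h => by simp at h⟩
  | succ n ih =>
    -- A maximal cell is an outer corner, so erasing it leaves a shape.
    obtain ⟨⟨p', q'⟩, hx⟩ := S.exists_maximal (Finset.card_pos.1 (by omega))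
    have hxS := hx.1
    obtain ⟨hp, hq⟩ := hS.1 _ _ hxS
    obtain ⟨p, rfl⟩ : ∃ p, p' = p + 1 := ⟨p' - 1, by omega⟩
    obtain ⟨q, rfl⟩ : ∃ q, q' = q + 1 := ⟨q' - 1, by omega⟩
    have hmax : ∀ i j, (i, j) ∈ S → p + 1 ≤ i → q + 1 ≤ j → i = p + 1 ∧ j = q + 1 := by
      intro i j hij h1 h2
      have := hx.2 hij (Prod.mk_le_mk.2 ⟨h1, h2⟩)
      rw [Prod.mk_le_mk] at this
      omega
    set S' := S.erase (p + 1, q + 1) with hS'def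
    have mem' : ∀ i j, (i, j) ∈ S' ↔ ¬ (i = p + 1 ∧ j = q + 1) ∧ (i, j) ∈ S := by
      intro i j
      rw [hS'def, Finset.mem_erase, Ne, Prod.mk.injEq]
    have hS' : IsShape S' := by
      refine ⟨fun i j h => hS.1 i j ((mem' i j).1 h).2, fun i j i' j' h h1 h2 h3 h4 => ?_⟩
      rw [mem'] at h ⊢
      refine ⟨?_, hS.2 i j i' j' h.2 h1 h2 h3 h4⟩
      rintro ⟨rfl, rfl⟩
      exact h.1 (hmax i j h.2 h3 h4)
    have hins : insert (p + 1, q + 1) S' = S := Finset.insert_erase hxS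
    have hnot : (p + 1, q + 1) ∉ S' := Finset.notMem_erase _ _
    obtain ⟨Φ, h1, h2, h3⟩ := ih S' hS' (by rw [Finset.card_erase_of_mem hxS, hn]; rfl)
    have hiff := monotoneOnCells_insert_iff hnot (by rwa [hins]) hS' hp hq
    rw [hins] at hiff
    refine ⟨(diagToggleEquiv _ _ hp hq).trans Φ, fun f => (hiff f).trans (h1 _), ?_, ?_⟩
    · intro f i j hij
      have : (i, j) ∉ S' := fun h => hij ((mem' i j).1 h).2
      rw [Equiv.trans_apply, h2 _ _ _ this]
      change diagToggle _ _ _ f i j = _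
      rw [diagToggle]
      rw [if_neg (by rintro ⟨rfl, rfl⟩; exact hij hxS), if_neg]
      rintro ⟨a, b, c, d⟩
      exact hij (hS.2 _ _ i j hxS a b (by omega) (by omega))
    · intro f hf i j hij hij'
      have hg := (hiff f).1 hf
      rw [Equiv.trans_apply]
      have hgdef : diagToggleEquiv _ _ hp hq f = diagToggle (p + 1) (q + 1) (-1) f := rfl
      set g := diagToggleEquiv _ _ hp hq f
      -- The induction hypothesis, extended to the axes, where both sums vanish; the recursion at a
      -- corner may reach them.
      have key : ∀ i j, (i = 0 ∨ j = 0 ∨ (i, j) ∈ S') → (i + 1, j + 1) ∉ S' →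
          diagSum g i j = rectSum (Φ g) i j := by
        rintro i j (rfl | rfl | hij) h'
        · simp [diagSum_zero_left, rectSum]
        · simp [diagSum_zero_right, rectSum]
        · exact h3 g hg i j hij h'
      by_cases hd : i = p + 1 ∧ j = q + 1
      · obtain ⟨rfl, rfl⟩ := hd
        have memS : ∀ i j, i ≤ p + 1 → j ≤ q + 1 → i + j < p + 1 + (q + 1) →
            (i = 0 ∨ j = 0 ∨ (i, j) ∈ S') := by
          intro i j ha hb hc
          by_cases hi : i = 0
          · exact Or.inl hi
          by_cases hj : j = 0
          · exact Or.inr (Or.inl hj)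
          refine Or.inr (Or.inr ((mem' i j).2 ⟨by omega, hS.2 _ _ i j hxS ?_ ?_ ha hb⟩)) <;> omega
        have out : ∀ i j, p + 1 ≤ i → q + 1 ≤ j → (i, j) ∉ S' := by
          intro i j ha hb h
          rw [mem'] at h
          exact h.1 (hmax i j h.2 ha hb)
        rw [rectSum_succ, ← key p (q + 1) (memS _ _ (by omega) (by omega) (by omega))
            (out _ _ (by omega) (by omega)),
          ← key (p + 1) q (memS _ _ (by omega) (by omega) (by omega))
            (out _ _ (by omega) (by omega)),
          ← key p q (memS _ _ (by omega) (by omega) (by omega)) (out _ _ (by omega) (by omega)),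
          h2 g _ _ hnot, hgdef, diagSum_diagToggle_of_ne _ _ _ _ (by omega),
          diagSum_diagToggle_of_ne _ _ _ _ (by omega), diagToggle_corner]
        have := diagSum_diagToggle_add (p := p + 1) (q := q + 1) (-1) hf.nonneg hf.row_zero
          hf.col_zero p q (by omega) (by omega)
        rw [diagSum_succ] at *
        simp only [Nat.add_sub_cancel]
        linarith
      · have hmem : (i, j) ∈ S' := (mem' i j).2 ⟨hd, hij⟩
        -- A cell that ends its diagonal in `S` and is not the removed corner lies on another
        -- diagonal, so its sum is not affected by the toggle.
        have hne : i + (q + 1) ≠ j + (p + 1) := by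
          intro he
          rcases lt_trichotomy i (p + 1) with h | h | h
          · exact hij' (hS.2 _ _ _ _ hxS (by omega) (by omega) (by omega) (by omega))
          · omega
          · have := hmax i j hij (by omega) (by omega)
            omega
        rw [← key i j (Or.inr (Or.inr hmem)) fun h => hij' ((mem' _ _).1 h).2, hgdef,
          diagSum_diagToggle_of_ne _ _ _ _ hne]

/-- The diagonals ending in the last row or last column partition the rectangle; the second sum
stops before row `a`, so the corner is counted once. -/
theorem sum_diagSum_boundary (f : ℕ → ℕ → ℤ) (a b : ℕ) :
    ∑ j ∈ Finset.range b, diagSum f a (j + 1) + ∑ i ∈ Finset.range a, diagSum f i b =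
      rectSum f a b := by
  induction a with
  | zero => simp [diagSum_zero_left, rectSum]
  | succ a ih =>
    have h : ∑ j ∈ Finset.range b, diagSum f a j + diagSum f a b =
        ∑ j ∈ Finset.range b, diagSum f a (j + 1) := by
      rw [← Finset.sum_range_succ, Finset.sum_range_succ', diagSum_zero_right, add_zero]
    simp only [rectSum, diagSum_succ, Finset.sum_add_distrib, Finset.sum_range_succ] at ih ⊢
    linarith

theorem sum_range_sum_range_succ (x : ℕ → ℤ) (b : ℕ) :
    ∑ j ∈ Finset.range b, ∑ q ∈ Finset.range (j + 1), x q =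
      ∑ q ∈ Finset.range b, ((b : ℤ) - q) * x q := by
  induction b with
  | zero => simp
  | succ b ih =>
    rw [Finset.sum_range_succ, ih, Finset.sum_range_succ, Finset.sum_range_succ _ b, ← add_assoc,
      ← Finset.sum_add_distrib]
    push_cast
    congr 1
    · exact Finset.sum_congr rfl fun q _ => by ring
    · ring

/-- The coefficient of a cell is the number of these rectangles containing it: `b - q` with corner
in the last row and `a - p - 1` others, in total its hook length. -/
theorem sum_rectSum_boundary (f : ℕ → ℕ → ℤ) (a b : ℕ) :
    ∑ j ∈ Finset.range b, rectSum f a (j + 1) + ∑ i ∈ Finset.range a, rectSum f i b =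
      ∑ p ∈ Finset.range a, ∑ q ∈ Finset.range b,
        ((a : ℤ) - p + (b - q) - 1) * f (p + 1) (q + 1) := by
  induction a with
  | zero => simp [rectSum]
  | succ a ih =>
    have h1 : ∀ j, rectSum f (a + 1) j =
        rectSum f a j + ∑ q ∈ Finset.range j, f (a + 1) (q + 1) := fun j => by
      rw [rectSum, Finset.sum_range_succ, rectSum]
    simp only [h1, Finset.sum_add_distrib]
    rw [sum_range_sum_range_succ (fun q => f (a + 1) (q + 1)), Finset.sum_range_succ,
      Finset.sum_range_succ]
    have h2 : ∑ p ∈ Finset.range a, ∑ q ∈ Finset.range b,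
        (((a + 1 : ℕ) : ℤ) - p + (b - q) - 1) * f (p + 1) (q + 1) =
        (∑ p ∈ Finset.range a, ∑ q ∈ Finset.range b,
          ((a : ℤ) - p + (b - q) - 1) * f (p + 1) (q + 1)) + rectSum f a b := by
      rw [rectSum, ← Finset.sum_add_distrib]
      refine Finset.sum_congr rfl fun p _ => ?_
      rw [← Finset.sum_add_distrib]
      refine Finset.sum_congr rfl fun q _ => ?_
      push_cast
      ring
    have h3 : ∑ q ∈ Finset.range b, (((a + 1 : ℕ) : ℤ) - a + (b - q) - 1) * f (a + 1) (q + 1) =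
        ∑ q ∈ Finset.range b, ((b : ℤ) - q) * f (a + 1) (q + 1) :=
      Finset.sum_congr rfl fun q _ => by push_cast; ring
    rw [h2, h3, ← ih]
    ring

/-! ### Plane partitions in a square and weighted fillings -/

/-- The array obtained by turning the leading `n × n` square of `a` around, with indices starting
from `1`. -/
def turnedArray (n : ℕ) (a : ℕ × ℕ →₀ ℕ) (i j : ℕ) : ℤ :=
  if (1 ≤ i ∧ i ≤ n) ∧ 1 ≤ j ∧ j ≤ n then (a (n - i, n - j) : ℤ) else 0

theorem turnedArray_apply (n : ℕ) (a : ℕ × ℕ →₀ ℕ) {i j : ℕ} (hi : i < n) (hj : j < n) :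
    turnedArray n a (n - i) (n - j) = a (i, j) := by
  rw [turnedArray, if_pos (by omega), Nat.sub_sub_self hi.le, Nat.sub_sub_self hj.le]

theorem sum_turnedArray (n : ℕ) (a : ℕ × ℕ →₀ ℕ) (c : ℕ → ℕ → ℤ) :
    ∑ p ∈ Finset.range n, ∑ q ∈ Finset.range n, c p q * turnedArray n a (p + 1) (q + 1) =
      ∑ i ∈ Finset.range n, ∑ j ∈ Finset.range n, c (n - 1 - i) (n - 1 - j) * a (i, j) := by
  rw [← Finset.sum_range_reflect]
  refine Finset.sum_congr rfl fun i hi => ?_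
  rw [← Finset.sum_range_reflect]
  refine Finset.sum_congr rfl fun j hj => ?_
  rw [Finset.mem_range] at hi hj
  rw [show n - 1 - i + 1 = n - i by omega, show n - 1 - j + 1 = n - j by omega,
    turnedArray_apply n a hi hj]

theorem injOn_turnedArray (n : ℕ) :
    Set.InjOn (turnedArray n) {a | a.support ⊆ Finset.range n ×ˢ Finset.range n} := by
  intro a ha b hb h
  ext ⟨i, j⟩
  by_cases hij : i < n ∧ j < n
  · have := congrFun (congrFun h (n - i)) (n - j)
    rw [turnedArray_apply n a hij.1 hij.2, turnedArray_apply n b hij.1 hij.2] at this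
    exact_mod_cast this
  · have out : ∀ c : ℕ × ℕ →₀ ℕ, c.support ⊆ Finset.range n ×ˢ Finset.range n → c (i, j) = 0 := by
      intro c hc
      by_contra hne
      have := hc (Finsupp.mem_support_iff.2 hne)
      simp only [Finset.mem_product, Finset.mem_range] at this
      exact hij this
    rw [out a ha, out b hb]

theorem exists_turnedArray_eq (n : ℕ) (f : ℕ → ℕ → ℤ) (h0 : ∀ i j, 0 ≤ f i j)
    (hf : ∀ i j, ¬ ((1 ≤ i ∧ i ≤ n) ∧ 1 ≤ j ∧ j ≤ n) → f i j = 0) :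
    ∃ a : ℕ × ℕ →₀ ℕ, a.support ⊆ Finset.range n ×ˢ Finset.range n ∧ turnedArray n a = f := by
  refine ⟨Finsupp.onFinset (Finset.range n ×ˢ Finset.range n)
    (fun p => (f (n - p.1) (n - p.2)).toNat) fun p hp => ?_, Finsupp.support_onFinset_subset, ?_⟩
  · simp only [Finset.mem_product, Finset.mem_range]
    by_contra hcon
    exact hp (by rw [hf _ _ (by omega), Int.toNat_zero])
  · funext i j
    rw [turnedArray]
    split_ifs with h
    · rw [Finsupp.onFinset_apply, Nat.sub_sub_self h.1.2, Nat.sub_sub_self h.2.2,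
        Int.toNat_of_nonneg (h0 _ _)]
    · exact (hf i j h).symm

theorem monotoneOnCells_turnedArray_iff (n : ℕ) (a : ℕ × ℕ →₀ ℕ)
    (ha : a.support ⊆ Finset.range n ×ˢ Finset.range n) :
    MonotoneOnCells (Finset.Icc 1 n ×ˢ Finset.Icc 1 n) (turnedArray n a) ↔
      (∀ i j, a (i, j + 1) ≤ a (i, j)) ∧ ∀ i j, a (i + 1, j) ≤ a (i, j) := by
  have out : ∀ i j, ¬ (i < n ∧ j < n) → a (i, j) = 0 := by
    intro i j hij
    by_contra hne
    have := ha (Finsupp.mem_support_iff.2 hne)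
    simp only [Finset.mem_product, Finset.mem_range] at this
    exact hij this
  constructor
  · intro h
    refine ⟨fun i j => ?_, fun i j => ?_⟩
    · by_cases hij : i < n ∧ j + 1 < n
      · have := h.row_le (n - i) (n - j) (by
          simp only [Finset.mem_product, Finset.mem_Icc]; omega)
        rw [turnedArray_apply n a hij.1 (by omega), show n - j - 1 = n - (j + 1) by omega,
          turnedArray_apply n a hij.1 hij.2] at this
        exact_mod_cast this
      · rw [out _ _ hij]; exact Nat.zero_le _
    · by_cases hij : i + 1 < n ∧ j < n
      · have := h.col_le (n - i) (n - j) (by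
          simp only [Finset.mem_product, Finset.mem_Icc]; omega)
        rw [turnedArray_apply n a (by omega) hij.2, show n - i - 1 = n - (i + 1) by omega,
          turnedArray_apply n a hij.1 hij.2] at this
        exact_mod_cast this
      · rw [out _ _ hij]; exact Nat.zero_le _
  · rintro ⟨hr, hc⟩
    have nonneg : ∀ i j, 0 ≤ turnedArray n a i j := by
      intro i j
      rw [turnedArray]
      split_ifs
      · exact Int.natCast_nonneg _
      · exact le_rfl
    refine ⟨nonneg, fun j => if_neg (by omega), fun i => if_neg (by omega), ?_, ?_⟩
    · intro i j hij
      simp only [Finset.mem_product, Finset.mem_Icc] at hij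
      rcases Nat.lt_or_ge 1 i with h1 | h1
      · rw [turnedArray, turnedArray, if_pos (by omega), if_pos hij,
          show n - (i - 1) = n - i + 1 by omega]
        exact_mod_cast hc _ _
      · refine le_trans (le_of_eq ?_) (nonneg _ _)
        exact if_neg (by omega)
    · intro i j hij
      simp only [Finset.mem_product, Finset.mem_Icc] at hij
      rcases Nat.lt_or_ge 1 j with h1 | h1
      · rw [turnedArray, turnedArray, if_pos (by omega), if_pos hij,
          show n - (j - 1) = n - j + 1 by omega]
        exact_mod_cast hr _ _
      · refine le_trans (le_of_eq ?_) (nonneg _ _)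
        exact if_neg (by omega)

theorem monotoneOnCells_empty_turnedArray (n : ℕ) (a : ℕ × ℕ →₀ ℕ) :
    MonotoneOnCells ∅ (turnedArray n a) := by
  refine ⟨fun i j => ?_, fun j => if_neg (by omega), fun i => if_neg (by omega), by simp, by simp⟩
  rw [turnedArray]
  split_ifs
  · exact Int.natCast_nonneg _
  · exact le_rfl

theorem isShape_square (n : ℕ) : IsShape (Finset.Icc 1 n ×ˢ Finset.Icc 1 n) := by
  simp only [IsShape, Finset.mem_product, Finset.mem_Icc]
  exact ⟨fun i j h => ⟨h.1.1, h.2.1⟩, fun i j i' j' h h1 h2 h3 h4 =>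
    ⟨⟨h1, h3.trans h.1.2⟩, h2, h4.trans h.2.2⟩⟩

/-- Plane partitions supported in an `n × n` square are equinumerous with fillings of the square,
the cell `(i, j)` being counted with weight `i + j + 1`. -/
theorem ncard_planePartition_square (n k : ℕ) :
    {a : ℕ × ℕ →₀ ℕ | a.support ⊆ Finset.range n ×ˢ Finset.range n ∧
      ((∀ i j, a (i, j + 1) ≤ a (i, j)) ∧ ∀ i j, a (i + 1, j) ≤ a (i, j)) ∧
      ∑ i ∈ Finset.range n, ∑ j ∈ Finset.range n, a (i, j) = k}.ncard =
    {a : ℕ × ℕ →₀ ℕ | a.support ⊆ Finset.range n ×ˢ Finset.range n ∧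
      ∑ i ∈ Finset.range n, ∑ j ∈ Finset.range n, (i + j + 1) * a (i, j) = k}.ncard := by
  obtain ⟨Φ, h1, h2, h3⟩ := exists_perm_diagSum_eq_rectSum _ (isShape_square n)
  have out_iff : ∀ i j, (i, j) ∉ Finset.Icc 1 n ×ˢ Finset.Icc 1 n ↔
      ¬ ((1 ≤ i ∧ i ≤ n) ∧ 1 ≤ j ∧ j ≤ n) := by
    intro i j
    simp only [Finset.mem_product, Finset.mem_Icc]
  have weight : ∀ a b : ℕ × ℕ →₀ ℕ, turnedArray n b = Φ (turnedArray n a) →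
      MonotoneOnCells (Finset.Icc 1 n ×ˢ Finset.Icc 1 n) (turnedArray n a) →
      ∑ i ∈ Finset.range n, ∑ j ∈ Finset.range n, a (i, j) =
        ∑ i ∈ Finset.range n, ∑ j ∈ Finset.range n, (i + j + 1) * b (i, j) := by
    intro a b hab hm
    have e1 := sum_diagSum_boundary (turnedArray n a) n n
    have e2 := sum_rectSum_boundary (turnedArray n b) n n
    have d1 : ∑ j ∈ Finset.range n, diagSum (turnedArray n a) n (j + 1) =
        ∑ j ∈ Finset.range n, rectSum (turnedArray n b) n (j + 1) := by
      refine Finset.sum_congr rfl fun j hj => ?_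
      rw [Finset.mem_range] at hj
      rw [hab]
      refine h3 _ hm n (j + 1) ?_ ?_ <;> simp only [Finset.mem_product, Finset.mem_Icc] <;> omega
    have d2 : ∑ i ∈ Finset.range n, diagSum (turnedArray n a) i n =
        ∑ i ∈ Finset.range n, rectSum (turnedArray n b) i n := by
      refine Finset.sum_congr rfl fun i hi => ?_
      rw [Finset.mem_range] at hi
      rcases Nat.eq_zero_or_pos i with rfl | hpos
      · simp [diagSum_zero_left, rectSum]
      rw [hab]
      refine h3 _ hm i n ?_ ?_ <;> simp only [Finset.mem_product, Finset.mem_Icc] <;> omega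
    have s1 := sum_turnedArray n a fun _ _ => 1
    -- Turning the square sends the hook length to `i + j + 1`.
    have s2 := sum_turnedArray n b fun p q => (n : ℤ) - p + (n - q) - 1
    simp only [one_mul] at s1
    rw [d1, d2, e2, s2, rectSum, s1] at e1
    zify
    rw [← e1]
    refine Finset.sum_congr rfl fun i hi => Finset.sum_congr rfl fun j hj => ?_
    rw [Finset.mem_range] at hi hj
    congr 1
    omega
  rw [← ((injOn_turnedArray n).mono fun a ha => ha.1).ncard_image,
    ← ((injOn_turnedArray n).mono (s₁ := {a : ℕ × ℕ →₀ ℕ |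
        a.support ⊆ Finset.range n ×ˢ Finset.range n ∧
        ∑ i ∈ Finset.range n, ∑ j ∈ Finset.range n, (i + j + 1) * a (i, j) = k})
      fun a ha => ha.1).ncard_image,
    ← Set.ncard_image_of_injective _ Φ.injective]
  congr 1
  ext g
  constructor
  · rintro ⟨_, ⟨a, ⟨ha, hm, hk⟩, rfl⟩, rfl⟩
    have hm' := (monotoneOnCells_turnedArray_iff n a ha).2 hm
    obtain ⟨b, hb, hba⟩ := exists_turnedArray_eq n (Φ (turnedArray n a))
      ((h1 _).1 hm').nonneg fun i j hij => by
        rw [h2 _ i j ((out_iff i j).2 hij)]; exact if_neg hij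
    exact ⟨b, ⟨hb, (weight a b hba hm').symm.trans hk⟩, hba⟩
  · rintro ⟨b, ⟨hb, hk⟩, rfl⟩
    obtain ⟨f, hf⟩ := Φ.surjective (turnedArray n b)
    have hm' : MonotoneOnCells _ f := (h1 f).2 (hf ▸ monotoneOnCells_empty_turnedArray n b)
    obtain ⟨a, ha, rfl⟩ := exists_turnedArray_eq n f hm'.nonneg fun i j hij => by
        rw [← h2 f i j ((out_iff i j).2 hij), hf]; exact if_neg hij
    exact ⟨_, ⟨a, ⟨ha, (monotoneOnCells_turnedArray_iff n a ha).1 hm',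
      (weight a b hf.symm hm').trans hk⟩, rfl⟩, hf⟩

theorem IsPlanePartition.support_subset {n : ℕ} {a : ℕ × ℕ →₀ ℕ} (h : IsPlanePartition n a) :
    a.support ⊆ Finset.range n ×ˢ Finset.range n := by
  obtain ⟨hr, hc, hs⟩ := h
  have key : ∀ g : ℕ → ℕ × ℕ, Function.Injective g → ∀ m, (∀ k ≤ m, a (g k) ≠ 0) → m < n := by
    intro g hg m hm
    have h1 : (Finset.range (m + 1)).image g ⊆ a.support := by
      intro p hp
      obtain ⟨k, hk, rfl⟩ := Finset.mem_image.1 hp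
      exact Finsupp.mem_support_iff.2 (hm k (Nat.lt_succ_iff.1 (Finset.mem_range.1 hk)))
    have h2 := Finset.card_le_card h1
    rw [Finset.card_image_of_injective _ hg, Finset.card_range] at h2
    have h3 : a.support.card • 1 ≤ ∑ p ∈ a.support, a p :=
      Finset.card_nsmul_le_sum _ _ _ fun p hp =>
        Nat.one_le_iff_ne_zero.2 (Finsupp.mem_support_iff.1 hp)
    rw [Finsupp.sum] at hs
    simp only [smul_eq_mul, mul_one] at h3
    omega
  rintro ⟨i, j⟩ hp
  have hp : a (i, j) ≠ 0 := Finsupp.mem_support_iff.1 hp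
  have hcol : Antitone fun k => a (k, j) := antitone_nat_of_succ_le fun k => hc k j
  have hrow : Antitone fun k => a (i, k) := antitone_nat_of_succ_le fun k => hr i k
  rw [Finset.mem_product, Finset.mem_range, Finset.mem_range]
  exact ⟨key (fun k => (k, j)) (fun x y h => by simpa using h) i fun k hk h0 =>
      hp (Nat.le_zero.1 (h0 ▸ hcol hk)),
    key (fun k => (i, k)) (fun x y h => by simpa using h) j fun k hk h0 =>
      hp (Nat.le_zero.1 (h0 ▸ hrow hk))⟩

theorem PL_eq_ncard_weighted {n k : ℕ} (hk : k ≤ n) :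
    PL k = {a : ℕ × ℕ →₀ ℕ | a.support ⊆ Finset.range n ×ˢ Finset.range n ∧
      ∑ i ∈ Finset.range n, ∑ j ∈ Finset.range n, (i + j + 1) * a (i, j) = k}.ncard := by
  rw [← ncard_planePartition_square, PL]
  congr 1
  have sum_eq : ∀ a : ℕ × ℕ →₀ ℕ, a.support ⊆ Finset.range n ×ˢ Finset.range n →
      (a.sum fun _ m => m) = ∑ i ∈ Finset.range n, ∑ j ∈ Finset.range n, a (i, j) := by
    intro a ha
    rw [← Finset.sum_product', Finsupp.sum_of_support_subset a ha _ fun _ _ => rfl]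
  ext a
  constructor
  · intro h
    have hs : a.support ⊆ Finset.range n ×ˢ Finset.range n :=
      h.support_subset.trans (Finset.product_subset_product (Finset.range_mono hk)
        (Finset.range_mono hk))
    exact ⟨hs, ⟨h.1, h.2.1⟩, (sum_eq a hs).symm.trans h.2.2⟩
  · rintro ⟨hs, ⟨h1, h2⟩, h3⟩
    exact ⟨h1, h2, (sum_eq a hs).trans h3⟩

/-! ### MacMahon's product -/

/-- The geometric series `∑ X ^ (k n)`. -/
noncomputable def geomSeries (k : ℕ) : PowerSeries ℝ :=
  PowerSeries.mk fun n => if k ∣ n then 1 else 0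

/-- The product of `1 / (1 - X ^ (i + j + 1))` over `i, j < n`. -/
noncomputable def macMahonProd (n : ℕ) : PowerSeries ℝ :=
  ∏ p ∈ Finset.range n ×ˢ Finset.range n, geomSeries (p.1 + p.2 + 1)

/-- A term of the expanded product picks a multiple of `i + j + 1` for each cell; the quotients form
a weighted filling. -/
theorem PL_eq_coeff {n k : ℕ} (hk : k ≤ n) :
    (PL k : ℝ) = PowerSeries.coeff k (macMahonProd n) := by
  set Q := Finset.range n ×ˢ Finset.range n with hQ
  have hcoeff : PowerSeries.coeff k (macMahonProd n) =
      (((Q.finsuppAntidiag k).filter fun l => ∀ p ∈ Q, p.1 + p.2 + 1 ∣ l p).card : ℝ) := by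
    rw [macMahonProd, PowerSeries.coeff_prod, Finset.card_filter]
    push_cast
    refine Finset.sum_congr rfl fun l _ => ?_
    simp only [geomSeries, PowerSeries.coeff_mk]
    rw [Finset.prod_boole]
  rw [hcoeff, PL_eq_ncard_weighted hk, ← Set.ncard_coe_finset]
  congr 1
  refine Set.ncard_congr (fun a _ => Finsupp.onFinset a.support
    (fun p => (p.1 + p.2 + 1) * a p) fun p hp => Finsupp.mem_support_iff.2 (by
      rintro h; exact hp (by rw [h, mul_zero]))) ?_ ?_ ?_
  · rintro a ⟨hs, hw⟩
    rw [Finset.mem_coe, Finset.mem_filter, Finset.mem_finsuppAntidiag]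
    refine ⟨⟨?_, Finsupp.support_onFinset_subset.trans hs⟩, fun p _ => Dvd.intro _ rfl⟩
    rw [hQ, Finset.sum_product]
    exact hw
  · intro a b _ _ h
    ext p
    have := DFunLike.congr_fun h p
    simpa using this
  · intro l hl
    rw [Finset.mem_coe, Finset.mem_filter, Finset.mem_finsuppAntidiag] at hl
    obtain ⟨⟨h1, h2⟩, h3⟩ := hl
    have hmul : ∀ p, (p.1 + p.2 + 1) * (l p / (p.1 + p.2 + 1)) = l p := by
      intro p
      by_cases hp : p ∈ Q
      · exact Nat.mul_div_cancel' (h3 p hp)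
      · rw [Finsupp.notMem_support_iff.1 fun h => hp (h2 h)]; simp
    refine ⟨Finsupp.onFinset l.support (fun p => l p / (p.1 + p.2 + 1)) fun p hp =>
      Finsupp.mem_support_iff.2 (by rintro h; exact hp (by rw [h, Nat.zero_div])),
      ⟨Finsupp.support_onFinset_subset.trans h2, ?_⟩, ?_⟩
    · rw [← h1, hQ, Finset.sum_product]
      exact Finset.sum_congr rfl fun i _ => Finset.sum_congr rfl fun j _ => hmul (i, j)
    · ext p
      exact hmul p

theorem geomSeries_eq_one_add {k : ℕ} (hk : 1 ≤ k) :
    geomSeries k = 1 + PowerSeries.X ^ k * geomSeries k := by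
  ext n
  rw [map_add, PowerSeries.coeff_X_pow_mul', PowerSeries.coeff_one]
  simp only [geomSeries, PowerSeries.coeff_mk]
  rcases Nat.eq_zero_or_pos n with rfl | hn
  · simp; omega
  · by_cases h : k ≤ n
    · have hiff : k ∣ n - k ↔ k ∣ n :=
        ⟨fun hd => Nat.sub_add_cancel h ▸ Nat.dvd_add hd dvd_rfl, fun hd => Nat.dvd_sub hd dvd_rfl⟩
      rw [if_neg hn.ne', if_pos h, zero_add]
      simp only [hiff]
    · rw [if_neg hn.ne', if_neg h, if_neg fun hd => h (Nat.le_of_dvd hn hd), add_zero]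

theorem derivative_geomSeries {k : ℕ} (hk : 1 ≤ k) :
    PowerSeries.derivative ℝ (geomSeries k) =
      (k : PowerSeries ℝ) * PowerSeries.X ^ (k - 1) * geomSeries k * geomSeries k := by
  have h := geomSeries_eq_one_add hk
  have hd := congrArg (PowerSeries.derivative ℝ) h
  rw [map_add, PowerSeries.derivative_one, Derivation.leibniz, PowerSeries.derivative_pow,
    PowerSeries.derivative_X] at hd
  simp only [smul_eq_mul, zero_add, mul_one] at hd
  set D := PowerSeries.derivative ℝ (geomSeries k)
  linear_combination geomSeries k * hd - D * h

/-- The series `∑_{n ≥ 1} X ^ (k n)`. -/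
noncomputable def geomTail (k : ℕ) : PowerSeries ℝ := PowerSeries.X ^ k * geomSeries k

theorem geomSeries_eq_one_add_geomTail {k : ℕ} (hk : 1 ≤ k) : geomSeries k = 1 + geomTail k :=
  geomSeries_eq_one_add hk

theorem geomTail_eq {k : ℕ} (hk : 1 ≤ k) :
    geomTail k = PowerSeries.X ^ k + PowerSeries.X ^ k * geomTail k := by
  conv_lhs => rw [geomTail, geomSeries_eq_one_add_geomTail hk]
  ring

/-- Applying `X d/dX` to `1 / (1 - X ^ k)` gives `k X ^ k / (1 - X ^ k) ^ 2`, which is `k (u ^ 2 +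
u)`. -/
theorem coeff_geomTail_sq_add {k : ℕ} (hk : 1 ≤ k) (n : ℕ) :
    PowerSeries.coeff n (geomTail k ^ 2 + geomTail k) = if k ∣ n then (n : ℝ) / k else 0 := by
  have h : PowerSeries.X * PowerSeries.derivative ℝ (geomSeries k) =
      (k : ℝ) • (geomTail k ^ 2 + geomTail k) := by
    rw [derivative_geomSeries hk, PowerSeries.smul_eq_C_mul, map_natCast]
    have e : (PowerSeries.X : PowerSeries ℝ) * PowerSeries.X ^ (k - 1) = PowerSeries.X ^ k := by
      rw [← pow_succ', Nat.sub_add_cancel hk]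
    have g := geomSeries_eq_one_add_geomTail hk
    have t : PowerSeries.X ^ k * geomSeries k = geomTail k := rfl
    linear_combination (k : PowerSeries ℝ) * geomSeries k * geomSeries k * e +
      (k : PowerSeries ℝ) * geomSeries k * t + (k : PowerSeries ℝ) * geomTail k * g
  have hk' : (k : ℝ) ≠ 0 := by exact_mod_cast (by omega : k ≠ 0)
  have hc := congrArg (PowerSeries.coeff n) h
  rw [map_smul, smul_eq_mul] at hc
  have : PowerSeries.coeff n (PowerSeries.X * PowerSeries.derivative ℝ (geomSeries k)) =
      if k ∣ n then (n : ℝ) else 0 := by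
    cases n with
    | zero => simp
    | succ n =>
      rw [PowerSeries.coeff_succ_X_mul, PowerSeries.coeff_derivative, geomSeries,
        PowerSeries.coeff_mk]
      push_cast
      split_ifs <;> simp
  rw [this] at hc
  rw [eq_comm, ← mul_right_inj' hk', ← hc]
  split_ifs
  · field_simp
  · simp

/-! ### The logarithm of the product -/

/-- The logarithm of the MacMahon product, up to terms of degree more than `N`. -/
noncomputable def logSeries (N : ℕ) : PowerSeries ℝ :=
  ∑ m ∈ Finset.Icc 1 N, (1 / (m : ℝ)) • (geomTail m ^ 2 + geomTail m)

theorem coeff_logSeries (N n : ℕ) : PowerSeries.coeff n (logSeries N) =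
    ∑ m ∈ Finset.Icc 1 N, if m ∣ n then (n : ℝ) / m ^ 2 else 0 := by
  rw [logSeries, map_sum]
  refine Finset.sum_congr rfl fun m hm => ?_
  rw [map_smul, coeff_geomTail_sq_add (Finset.mem_Icc.1 hm).1, smul_eq_mul]
  split_ifs
  · rw [div_mul_div_comm, one_mul, sq]
  · rw [mul_zero]

theorem derivative_prod_of_logDeriv {ι : Type*} (s : Finset ι) (Y g : ι → PowerSeries ℝ)
    (h : ∀ i ∈ s, PowerSeries.derivative ℝ (Y i) = g i * Y i) :
    PowerSeries.derivative ℝ (∏ i ∈ s, Y i) = (∑ i ∈ s, g i) * ∏ i ∈ s, Y i := by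
  classical
  induction s using Finset.induction_on with
  | empty => simp
  | insert a s ha ih =>
    rw [Finset.prod_insert ha, Finset.sum_insert ha, Derivation.leibniz,
      ih fun i hi => h i (Finset.mem_insert_of_mem hi), h a (Finset.mem_insert_self _ _)]
    simp only [smul_eq_mul]
    ring

/-- Exactly `d` cells satisfy `i + j + 1 = d`, all inside the square because `d ≤ n ≤ N`. -/
theorem sum_square_dvd {N n : ℕ} (hn : 1 ≤ n) (hN : n ≤ N) :
    ∑ p ∈ Finset.range N ×ˢ Finset.range N,
      (if p.1 + p.2 + 1 ∣ n then ((p.1 + p.2 + 1 : ℕ) : ℝ) else 0) =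
    ∑ d ∈ n.divisors, (d : ℝ) ^ 2 := by
  have h1 : ∀ p ∈ Finset.range N ×ˢ Finset.range N,
      (if p.1 + p.2 + 1 ∣ n then ((p.1 + p.2 + 1 : ℕ) : ℝ) else 0) =
      ∑ d ∈ n.divisors, if p.1 + p.2 + 1 = d then (d : ℝ) else 0 := by
    intro p _
    rw [Finset.sum_ite_eq]
    simp only [Nat.mem_divisors]
    congr 1
    exact propext ⟨fun h => ⟨h, by omega⟩, fun h => h.1⟩
  rw [Finset.sum_congr rfl h1, Finset.sum_comm]
  refine Finset.sum_congr rfl fun d hd => ?_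
  have hdn := Nat.divisor_le hd
  have hd0 := Nat.pos_of_mem_divisors hd
  rw [← Finset.sum_filter, Finset.sum_const]
  have : (Finset.range N ×ˢ Finset.range N).filter (fun p => p.1 + p.2 + 1 = d) =
      Finset.HasAntidiagonal.antidiagonal (d - 1) := by
    ext p
    simp only [Finset.mem_filter, Finset.mem_product, Finset.mem_range, Finset.HasAntidiagonal.mem_antidiagonal]
    omega
  rw [this, Finset.Nat.card_antidiagonal, Nat.sub_add_cancel hd0, nsmul_eq_mul, sq]

theorem mul_coeff_logSeries {N n : ℕ} (hn : 1 ≤ n) (hN : n ≤ N) :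
    n * PowerSeries.coeff n (logSeries N) = ∑ d ∈ n.divisors, (d : ℝ) ^ 2 := by
  rw [coeff_logSeries, ← Finset.sum_filter, ← Nat.sum_div_divisors n fun d => (d : ℝ) ^ 2,
    Finset.mul_sum]
  refine Finset.sum_congr ?_ fun d hd => ?_
  · ext d
    simp only [Finset.mem_filter, Finset.mem_Icc, Nat.mem_divisors]
    constructor
    · exact fun h => ⟨h.2, by omega⟩
    · exact fun h => ⟨⟨Nat.pos_of_dvd_of_pos h.1 hn, (Nat.le_of_dvd hn h.1).trans hN⟩, h.1⟩
  · have hd' := Nat.dvd_of_mem_divisors hd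
    have hd0 : (d : ℝ) ≠ 0 := by exact_mod_cast (Nat.pos_of_mem_divisors hd).ne'
    rw [Nat.cast_div hd' hd0]
    field_simp

/-- This is `Y' = L' Y` in degree `n`: both logarithmic derivatives have the divisor sums of squares
as coefficients in the degrees involved. -/
theorem coeff_succ_macMahonProd {N n : ℕ} (hn : n + 1 ≤ N) :
    (n + 1 : ℝ) * PowerSeries.coeff (n + 1) (macMahonProd N) =
      ∑ p ∈ Finset.HasAntidiagonal.antidiagonal n, PowerSeries.coeff p.1 (PowerSeries.derivative ℝ (logSeries N)) *
        PowerSeries.coeff p.2 (macMahonProd N) := by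
  have h := derivative_prod_of_logDeriv (Finset.range N ×ˢ Finset.range N)
    (fun p => geomSeries (p.1 + p.2 + 1))
    (fun p => ((p.1 + p.2 + 1 : ℕ) : PowerSeries ℝ) * PowerSeries.X ^ (p.1 + p.2) *
      geomSeries (p.1 + p.2 + 1)) fun p _ => by
        simpa using derivative_geomSeries (k := p.1 + p.2 + 1) (by omega)
  have hc := congrArg (PowerSeries.coeff n) h
  rw [PowerSeries.coeff_derivative, PowerSeries.coeff_mul] at hc
  rw [mul_comm]
  refine hc.trans (Finset.sum_congr rfl fun p hp => ?_)
  rw [Finset.HasAntidiagonal.mem_antidiagonal] at hp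
  congr 1
  rw [PowerSeries.coeff_derivative, mul_comm]
  have e := mul_coeff_logSeries (N := N) (n := p.1 + 1) (by omega) (by omega)
  push_cast at e
  rw [e, ← sum_square_dvd (N := N) (by omega) (by omega), map_sum]
  refine Finset.sum_congr rfl fun q _ => ?_
  rw [← map_natCast (PowerSeries.C (R := ℝ)), mul_assoc, PowerSeries.coeff_C_mul,
    PowerSeries.coeff_X_pow_mul', geomSeries, PowerSeries.coeff_mk]
  by_cases hd : q.1 + q.2 + 1 ∣ p.1 + 1
  · have hle := Nat.le_of_dvd (by omega) hd
    have : q.1 + q.2 + 1 ∣ p.1 - (q.1 + q.2) := by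
      rw [show p.1 - (q.1 + q.2) = p.1 + 1 - (q.1 + q.2 + 1) by omega]
      exact Nat.dvd_sub hd dvd_rfl
    rw [if_pos (by omega), if_pos this, if_pos hd, mul_one]
  · rw [if_neg hd]
    split_ifs with h1 h2
    · refine absurd ?_ hd
      rw [show p.1 + 1 = p.1 - (q.1 + q.2) + (q.1 + q.2 + 1) by omega]
      exact Nat.dvd_add h2 dvd_rfl
    · rw [mul_zero]
    · rw [mul_zero]

theorem coeff_logSeries_zero (N : ℕ) : PowerSeries.coeff 0 (logSeries N) = 0 := by
  rw [coeff_logSeries]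
  simp

theorem coeff_logSeries_pow (N : ℕ) {n k : ℕ} (h : n < k) :
    PowerSeries.coeff n (logSeries N ^ k) = 0 := by
  have hX : PowerSeries.X ∣ logSeries N := by
    rw [PowerSeries.X_dvd_iff, ← PowerSeries.coeff_zero_eq_constantCoeff_apply,
      coeff_logSeries_zero]
  exact PowerSeries.X_pow_dvd_iff.1 (pow_dvd_pow_of_dvd hX k) n h

/-- The exponential of `P`, truncated after `K` terms. -/
noncomputable def truncExp (K : ℕ) (P : PowerSeries ℝ) : PowerSeries ℝ :=
  ∑ n ∈ Finset.range K, (1 / (n ! : ℝ)) • P ^ n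

theorem derivative_truncExp_succ (K : ℕ) (P : PowerSeries ℝ) :
    PowerSeries.derivative ℝ (truncExp (K + 1) P) =
      PowerSeries.derivative ℝ P * truncExp K P := by
  rw [truncExp, Finset.sum_range_succ', map_add, map_sum, truncExp, Finset.mul_sum]
  have : PowerSeries.derivative ℝ ((1 / (0 ! : ℝ)) • P ^ 0) = 0 := by
    rw [Derivation.map_smul, pow_zero, PowerSeries.derivative_one, smul_zero]
  rw [this, add_zero]
  refine Finset.sum_congr rfl fun n _ => ?_
  rw [Derivation.map_smul, PowerSeries.derivative_pow, Nat.add_sub_cancel, mul_assoc,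
    ← map_natCast (PowerSeries.C (R := ℝ)), ← PowerSeries.smul_eq_C_mul, smul_smul,
    mul_smul_comm, mul_comm (P ^ n)]
  congr 1
  rw [Nat.factorial_succ]
  push_cast
  have : (n ! : ℝ) ≠ 0 := by exact_mod_cast n.factorial_ne_zero
  field_simp

/-- Both sides start with `1` and obey the recursion from `Y' = L' Y`. Since `X` divides `L`, the
powers omitted from the exponential do not reach degree `N`. -/
theorem coeff_macMahonProd_eq {N K : ℕ} (hK : N < K) (n : ℕ) (hn : n ≤ N) :
    PowerSeries.coeff n (macMahonProd N) = PowerSeries.coeff n (truncExp K (logSeries N)) := by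
  induction n using Nat.strong_induction_on with
  | _ n ih =>
    cases n with
    | zero =>
      have h1 : PowerSeries.coeff 0 (macMahonProd N) = 1 := by
        rw [PowerSeries.coeff_zero_eq_constantCoeff_apply, macMahonProd, map_prod]
        refine Finset.prod_eq_one fun p _ => ?_
        rw [← PowerSeries.coeff_zero_eq_constantCoeff_apply, geomSeries, PowerSeries.coeff_mk]
        simp
      obtain ⟨L, rfl⟩ : ∃ L, K = L + 1 := ⟨K - 1, by omega⟩
      rw [h1, truncExp, map_sum, Finset.sum_range_succ', Finset.sum_eq_zero]
      · simp
      · intro k _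
        rw [map_smul, coeff_logSeries_pow N (Nat.succ_pos k), smul_zero]
    | succ n =>
      obtain ⟨L, rfl⟩ : ∃ L, K = L + 1 := ⟨K - 1, by omega⟩
      have h1 := coeff_succ_macMahonProd hn
      have h2 := congrArg (PowerSeries.coeff n) (derivative_truncExp_succ L (logSeries N))
      rw [PowerSeries.coeff_derivative, PowerSeries.coeff_mul] at h2
      have h3 : (n + 1 : ℝ) ≠ 0 := by positivity
      rw [← mul_right_inj' h3, h1, mul_comm, h2]
      refine Finset.sum_congr rfl fun p hp => ?_
      rw [Finset.HasAntidiagonal.mem_antidiagonal] at hp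
      rw [ih p.2 (by omega) (by omega), truncExp, Finset.sum_range_succ, map_add, map_smul,
        coeff_logSeries_pow N (by omega), smul_zero, add_zero, truncExp]

/-! ### Sums of coefficients and Riemann sums -/

/-- The sum of the coefficients of degree at most `N`, as a linear form. -/
noncomputable def coeffSum (N : ℕ) : PowerSeries ℝ →ₗ[ℝ] ℝ :=
  ∑ n ∈ Finset.range (N + 1), PowerSeries.coeff n

theorem coeffSum_apply (N : ℕ) (P : PowerSeries ℝ) :
    coeffSum N P = ∑ n ∈ Finset.range (N + 1), PowerSeries.coeff n P := by
  rw [coeffSum, LinearMap.sum_apply]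

theorem coeffSum_one (N : ℕ) : coeffSum N 1 = 1 := by
  simp [coeffSum_apply, PowerSeries.coeff_one]

theorem coeffSum_X_pow_mul {N m : ℕ} (h : m ≤ N) (P : PowerSeries ℝ) :
    coeffSum N (PowerSeries.X ^ m * P) = coeffSum (N - m) P := by
  rw [coeffSum_apply, coeffSum_apply, show N + 1 = m + (N - m + 1) by omega,
    Finset.sum_range_add, Finset.sum_eq_zero, zero_add]
  · refine Finset.sum_congr rfl fun n _ => ?_
    rw [PowerSeries.coeff_X_pow_mul', if_pos (by omega), Nat.add_sub_cancel_left]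
  · intro n hn
    rw [Finset.mem_range] at hn
    rw [PowerSeries.coeff_X_pow_mul', if_neg (by omega)]

theorem coeffSum_X_pow_mul_of_lt {N m : ℕ} (h : N < m) (P : PowerSeries ℝ) :
    coeffSum N (PowerSeries.X ^ m * P) = 0 := by
  rw [coeffSum_apply]
  refine Finset.sum_eq_zero fun n hn => ?_
  rw [Finset.mem_range] at hn
  rw [PowerSeries.coeff_X_pow_mul', if_neg (by omega)]

theorem mul_pow_le_pow_sub_pow {x y : ℝ} (hx : 0 ≤ x) (hxy : x ≤ y) (r : ℕ) :
    (r + 1) * (y - x) * x ^ r ≤ y ^ (r + 1) - x ^ (r + 1) := by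
  induction r with
  | zero => simp
  | succ r ih =>
    have h1 : 0 ≤ (r + 1) * (y - x) * x ^ r := by
      have := sub_nonneg.2 hxy
      positivity
    have h2 : x * ((r + 1) * (y - x) * x ^ r) ≤ y * (y ^ (r + 1) - x ^ (r + 1)) :=
      (mul_le_mul_of_nonneg_right hxy h1).trans (mul_le_mul_of_nonneg_left ih (hx.trans hxy))
    push_cast
    linear_combination h2

theorem pow_sub_pow_le_mul_pow {x y : ℝ} (hx : 0 ≤ x) (hxy : x ≤ y) (r : ℕ) :
    y ^ (r + 1) - x ^ (r + 1) ≤ (r + 1) * (y - x) * y ^ r := by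
  induction r with
  | zero => simp
  | succ r ih =>
    have h1 := mul_le_mul_of_nonneg_left ih (hx.trans hxy)
    have h2 : (y - x) * x ^ (r + 1) ≤ (y - x) * y ^ (r + 1) :=
      mul_le_mul_of_nonneg_left (pow_le_pow_left₀ hx hxy _) (sub_nonneg.2 hxy)
    push_cast
    linear_combination h1 + h2

theorem div_mul_pow_succ_div_factorial {m : ℕ} (hm : 1 ≤ m) (c x : ℝ) (r : ℕ) :
    c / m * (x ^ (r + 1) / (r + 1)!) = c / ((r + 1) * m * r !) * x ^ (r + 1) := by
  rw [Nat.factorial_succ]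
  push_cast
  have : (m : ℝ) ≠ 0 := by exact_mod_cast (by omega : m ≠ 0)
  have : (r ! : ℝ) ≠ 0 := by exact_mod_cast r.factorial_ne_zero
  field_simp

theorem mul_pow_div_factorial {m : ℕ} (hm : 1 ≤ m) (c x : ℝ) (r : ℕ) :
    c * (x ^ r / r !) = c / ((r + 1) * m * r !) * ((r + 1) * m * x ^ r) := by
  have : (m : ℝ) ≠ 0 := by exact_mod_cast (by omega : m ≠ 0)
  have : (r ! : ℝ) ≠ 0 := by exact_mod_cast r.factorial_ne_zero
  field_simp

/-- The left side adds the coefficient sums of `P` at `M - m`, `M - 2m`, and so on, a lower Riemann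
sum of step `m` for the integral of `t ^ r`. The induction takes one step of length `m` at a time.
-/
theorem coeffSum_geomTail_mul_le {m : ℕ} (hm : 1 ≤ m) {P : PowerSeries ℝ} {c : ℝ} (hc : 0 ≤ c)
    {r : ℕ} (hP : ∀ M : ℕ, coeffSum M P ≤ c * ((M : ℝ) ^ r / r !)) (M : ℕ) :
    coeffSum M (geomTail m * P) ≤ c / m * ((M : ℝ) ^ (r + 1) / (r + 1)!) := by
  induction M using Nat.strong_induction_on with
  | _ M ih =>
    rcases Nat.lt_or_ge M m with h | h
    · rw [geomTail, mul_assoc, coeffSum_X_pow_mul_of_lt h]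
      positivity
    · have e : geomTail m * P = PowerSeries.X ^ m * P + PowerSeries.X ^ m * (geomTail m * P) := by
        linear_combination P * geomTail_eq hm
      rw [e, map_add, coeffSum_X_pow_mul h, coeffSum_X_pow_mul h]
      refine (add_le_add (hP _) (ih _ (by omega))).trans ?_
      rw [div_mul_pow_succ_div_factorial hm, div_mul_pow_succ_div_factorial hm,
        mul_pow_div_factorial hm, ← mul_add]
      refine mul_le_mul_of_nonneg_left ?_ (by positivity)
      have := mul_pow_le_pow_sub_pow (x := ((M - m : ℕ) : ℝ)) (y := M) (Nat.cast_nonneg _)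
        (by exact_mod_cast Nat.sub_le _ _) r
      rw [show (M : ℝ) - ((M - m : ℕ) : ℝ) = m by rw [Nat.cast_sub h]; ring] at this
      linarith

/-- Now the term at `M` itself is included, so the Riemann sum is an upper one. -/
theorem le_coeffSum_geomSeries_mul {m : ℕ} (hm : 1 ≤ m) {P : PowerSeries ℝ} {c : ℝ} (hc : 0 ≤ c)
    {r : ℕ} (hP : ∀ M : ℕ, c * ((M : ℝ) ^ r / r !) ≤ coeffSum M P) (M : ℕ) :
    c / m * ((M : ℝ) ^ (r + 1) / (r + 1)!) ≤ coeffSum M (geomSeries m * P) := by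
  induction M using Nat.strong_induction_on with
  | _ M ih =>
    have e : geomSeries m * P = P + PowerSeries.X ^ m * (geomSeries m * P) := by
      linear_combination P * geomSeries_eq_one_add hm
    rw [e, map_add]
    have hP' := hP M
    rw [mul_pow_div_factorial hm] at hP'
    rw [div_mul_pow_succ_div_factorial hm]
    have hc' : 0 ≤ c / ((r + 1) * m * r !) := by positivity
    rcases Nat.lt_or_ge M m with h | h
    · rw [coeffSum_X_pow_mul_of_lt h, add_zero]
      refine le_trans (mul_le_mul_of_nonneg_left ?_ hc') hP'
      rw [pow_succ']
      refine mul_le_mul_of_nonneg_right ?_ (by positivity)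
      have h1 : (M : ℝ) ≤ m := by exact_mod_cast h.le
      have h2 : (0 : ℝ) ≤ r * m := by positivity
      linarith
    · rw [coeffSum_X_pow_mul h]
      have ih' := ih (M - m) (by omega)
      rw [div_mul_pow_succ_div_factorial hm] at ih'
      refine le_trans ?_ (add_le_add hP' ih')
      rw [← mul_add]
      refine mul_le_mul_of_nonneg_left ?_ hc'
      have := pow_sub_pow_le_mul_pow (x := ((M - m : ℕ) : ℝ)) (y := M) (Nat.cast_nonneg _)
        (by exact_mod_cast Nat.sub_le _ _) r
      rw [show (M : ℝ) - ((M - m : ℕ) : ℝ) = m by rw [Nat.cast_sub h]; ring] at this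
      linarith

/-! ### Powers of the series in the exponent -/

/-- The series `∑_{m ≤ N} u_m / m` with `u_m = X ^ m / (1 - X ^ m)`. -/
noncomputable def tailSeries (N : ℕ) : PowerSeries ℝ :=
  ∑ m ∈ Finset.Icc 1 N, (1 / (m : ℝ)) • geomTail m

/-- The series `∑_{m ≤ N} u_m ^ 2 / m` with `u_m = X ^ m / (1 - X ^ m)`. -/
noncomputable def tailSqSeries (N : ℕ) : PowerSeries ℝ :=
  ∑ m ∈ Finset.Icc 1 N, (1 / (m : ℝ)) • geomTail m ^ 2

/-- The series `∑_{m ≤ N} v_m ^ 2 / m` with `v_m = 1 / (1 - X ^ m)`. -/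
noncomputable def geomSqSeries (N : ℕ) : PowerSeries ℝ :=
  ∑ m ∈ Finset.Icc 1 N, (1 / (m : ℝ)) • geomSeries m ^ 2

theorem logSeries_eq (N : ℕ) : logSeries N = tailSqSeries N + tailSeries N := by
  simp only [logSeries, tailSqSeries, tailSeries, smul_add, Finset.sum_add_distrib]

theorem geomSqSeries_eq (N : ℕ) : geomSqSeries N =
    logSeries N + (tailSeries N + PowerSeries.C (∑ m ∈ Finset.Icc 1 N, 1 / (m : ℝ))) := by
  rw [geomSqSeries, logSeries, tailSeries, map_sum, ← Finset.sum_add_distrib,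
    ← Finset.sum_add_distrib]
  refine Finset.sum_congr rfl fun m hm => ?_
  rw [geomSeries_eq_one_add_geomTail (Finset.mem_Icc.1 hm).1]
  simp only [PowerSeries.smul_eq_C_mul]
  ring

theorem truncZeta_natCast (N s : ℕ) :
    truncZeta N (s : ℝ) = ∑ m ∈ Finset.Icc 1 N, 1 / (m : ℝ) ^ s := by
  simp only [truncZeta, Real.rpow_natCast]

theorem truncZeta_nonneg (N : ℕ) (s : ℝ) : 0 ≤ truncZeta N s :=
  Finset.sum_nonneg fun m _ => by positivity

theorem coeffSum_sum_smul_mul (M N : ℕ) (Y : ℕ → PowerSeries ℝ) (P : PowerSeries ℝ) :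
    coeffSum M ((∑ m ∈ Finset.Icc 1 N, (1 / (m : ℝ)) • Y m) * P) =
      ∑ m ∈ Finset.Icc 1 N, 1 / (m : ℝ) * coeffSum M (Y m * P) := by
  rw [Finset.sum_mul, map_sum]
  refine Finset.sum_congr rfl fun m _ => ?_
  rw [smul_mul_assoc, map_smul, smul_eq_mul]

theorem coeffSum_tailSeries_pow_le (N n M : ℕ) :
    coeffSum M (tailSeries N ^ n) ≤ truncZeta N 2 ^ n * ((M : ℝ) ^ n / n !) := by
  induction n generalizing M with
  | zero => simp [coeffSum_one]
  | succ n ih =>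
    have hz := truncZeta_natCast N 2
    rw [Nat.cast_ofNat] at hz
    rw [pow_succ', tailSeries, coeffSum_sum_smul_mul, pow_succ' (truncZeta N 2)]
    nth_rewrite 1 [hz]
    rw [Finset.sum_mul, Finset.sum_mul]
    refine Finset.sum_le_sum fun m hm => ?_
    have h := coeffSum_geomTail_mul_le (Finset.mem_Icc.1 hm).1
      (pow_nonneg (truncZeta_nonneg N 2) n) ih M
    refine (mul_le_mul_of_nonneg_left h (by positivity)).trans (le_of_eq ?_)
    ring

/-- Each of the two factors `u` contributes `1 / m` and one integration; with the weight `1 / m`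
this makes `1 / m ^ 3`. -/
theorem coeffSum_tailSqSeries_pow_le (N n M : ℕ) :
    coeffSum M (tailSqSeries N ^ n) ≤
      truncZeta N 3 ^ n * ((M : ℝ) ^ (2 * n) / (2 * n)!) := by
  induction n generalizing M with
  | zero => simp [coeffSum_one]
  | succ n ih =>
    have hz := truncZeta_natCast N 3
    rw [Nat.cast_ofNat] at hz
    rw [pow_succ', tailSqSeries, coeffSum_sum_smul_mul, pow_succ' (truncZeta N 3)]
    nth_rewrite 1 [hz]
    rw [Finset.sum_mul, Finset.sum_mul]
    refine Finset.sum_le_sum fun m hm => ?_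
    have hm := (Finset.mem_Icc.1 hm).1
    have h0 := pow_nonneg (truncZeta_nonneg N 3) n
    have h := coeffSum_geomTail_mul_le hm (by positivity)
      (coeffSum_geomTail_mul_le hm h0 ih) M
    rw [← mul_assoc, ← sq] at h
    refine (mul_le_mul_of_nonneg_left h (by positivity)).trans (le_of_eq ?_)
    rw [show 2 * (n + 1) = 2 * n + 1 + 1 by ring]
    ring

theorem le_coeffSum_geomSqSeries_pow (N n M : ℕ) :
    truncZeta N 3 ^ n * ((M : ℝ) ^ (2 * n) / (2 * n)!) ≤ coeffSum M (geomSqSeries N ^ n) := by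
  induction n generalizing M with
  | zero => simp [coeffSum_one]
  | succ n ih =>
    have hz := truncZeta_natCast N 3
    rw [Nat.cast_ofNat] at hz
    rw [pow_succ' (geomSqSeries N), geomSqSeries, coeffSum_sum_smul_mul, pow_succ' (truncZeta N 3)]
    nth_rewrite 1 [hz]
    rw [Finset.sum_mul, Finset.sum_mul]
    refine Finset.sum_le_sum fun m hm => ?_
    have hm := (Finset.mem_Icc.1 hm).1
    have h0 := pow_nonneg (truncZeta_nonneg N 3) n
    have h := le_coeffSum_geomSeries_mul hm (by positivity)
      (le_coeffSum_geomSeries_mul hm h0 ih) M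
    rw [← mul_assoc, ← sq] at h
    refine le_trans (le_of_eq ?_) (mul_le_mul_of_nonneg_left h (by positivity))
    rw [show 2 * (n + 1) = 2 * n + 1 + 1 by ring]
    ring

/-! ### Non-negative coefficients and truncated exponentials -/

/-- A power series with non-negative coefficients. -/
def CoeffNonneg (P : PowerSeries ℝ) : Prop := ∀ n, 0 ≤ PowerSeries.coeff n P

theorem CoeffNonneg.add {P Q : PowerSeries ℝ} (hP : CoeffNonneg P) (hQ : CoeffNonneg Q) :
    CoeffNonneg (P + Q) := fun n => by
  rw [map_add]; exact add_nonneg (hP n) (hQ n)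

theorem CoeffNonneg.mul {P Q : PowerSeries ℝ} (hP : CoeffNonneg P) (hQ : CoeffNonneg Q) :
    CoeffNonneg (P * Q) := fun n => by
  rw [PowerSeries.coeff_mul]
  exact Finset.sum_nonneg fun p _ => mul_nonneg (hP _) (hQ _)

theorem coeffNonneg_C {c : ℝ} (hc : 0 ≤ c) : CoeffNonneg (PowerSeries.C c) := fun n => by
  rw [PowerSeries.coeff_C]
  split_ifs
  exacts [hc, le_rfl]

theorem CoeffNonneg.pow {P : PowerSeries ℝ} (hP : CoeffNonneg P) (k : ℕ) :
    CoeffNonneg (P ^ k) := by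
  induction k with
  | zero => simpa using coeffNonneg_C zero_le_one
  | succ k ih => rw [pow_succ]; exact ih.mul hP

theorem coeffNonneg_geomTail (m : ℕ) : CoeffNonneg (geomTail m) := fun n => by
  rw [geomTail, PowerSeries.coeff_X_pow_mul', geomSeries, PowerSeries.coeff_mk]
  split_ifs <;> norm_num

theorem coeffNonneg_sum_smul (N : ℕ) {Y : ℕ → PowerSeries ℝ} (hY : ∀ m, CoeffNonneg (Y m)) :
    CoeffNonneg (∑ m ∈ Finset.Icc 1 N, (1 / (m : ℝ)) • Y m) := fun n => by
  rw [map_sum]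
  refine Finset.sum_nonneg fun m _ => ?_
  rw [map_smul]
  exact mul_nonneg (by positivity) (hY m n)

theorem coeffNonneg_tailSeries (N : ℕ) : CoeffNonneg (tailSeries N) :=
  coeffNonneg_sum_smul N coeffNonneg_geomTail

theorem coeffNonneg_tailSqSeries (N : ℕ) : CoeffNonneg (tailSqSeries N) :=
  coeffNonneg_sum_smul N fun m => (coeffNonneg_geomTail m).pow 2

theorem coeffNonneg_logSeries (N : ℕ) : CoeffNonneg (logSeries N) :=
  logSeries_eq N ▸ (coeffNonneg_tailSqSeries N).add (coeffNonneg_tailSeries N)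

theorem coeffSum_nonneg {P : PowerSeries ℝ} (hP : CoeffNonneg P) (N : ℕ) : 0 ≤ coeffSum N P := by
  rw [coeffSum_apply]
  exact Finset.sum_nonneg fun n _ => hP n

theorem sum_antidiagonal_le_mul_sum {a b : ℕ → ℝ} (ha : ∀ n, 0 ≤ a n) (hb : ∀ n, 0 ≤ b n)
    (K : ℕ) : ∑ n ∈ Finset.range K, ∑ p ∈ Finset.HasAntidiagonal.antidiagonal n, a p.1 * b p.2 ≤
      (∑ n ∈ Finset.range K, a n) * ∑ n ∈ Finset.range K, b n := by
  simp only [Finset.Nat.sum_antidiagonal_eq_sum_range_succ_mk]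
  rw [Finset.sum_range_diag_flip K fun i j => a i * b j, Finset.sum_mul_sum]
  refine Finset.sum_le_sum fun i _ => ?_
  exact Finset.sum_le_sum_of_subset_of_nonneg (Finset.range_mono (Nat.sub_le _ _))
    fun j _ _ => mul_nonneg (ha i) (hb j)

/-- The pairs of degrees with sum at most `N` are among those with each degree at most `N`. -/
theorem coeffSum_mul_le {P Q : PowerSeries ℝ} (hP : CoeffNonneg P) (hQ : CoeffNonneg Q) (N : ℕ) :
    coeffSum N (P * Q) ≤ coeffSum N P * coeffSum N Q := by
  simp only [coeffSum_apply, PowerSeries.coeff_mul]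
  exact sum_antidiagonal_le_mul_sum hP hQ _

theorem coeffSum_truncExp (N K : ℕ) (P : PowerSeries ℝ) :
    coeffSum N (truncExp K P) = ∑ n ∈ Finset.range K, coeffSum N (P ^ n) / n ! := by
  rw [truncExp, map_sum]
  refine Finset.sum_congr rfl fun n _ => ?_
  rw [map_smul, smul_eq_mul, one_div_mul_eq_div]

theorem coeffSum_truncExp_nonneg (N K : ℕ) {P : PowerSeries ℝ} (hP : CoeffNonneg P) :
    0 ≤ coeffSum N (truncExp K P) := by
  rw [coeffSum_truncExp]
  exact Finset.sum_nonneg fun n _ => div_nonneg (coeffSum_nonneg (hP.pow n) N) (by positivity)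

theorem coeffSum_truncExp_mono (N : ℕ) {P : PowerSeries ℝ} (hP : CoeffNonneg P) {K L : ℕ}
    (h : K ≤ L) : coeffSum N (truncExp K P) ≤ coeffSum N (truncExp L P) := by
  rw [coeffSum_truncExp, coeffSum_truncExp]
  exact Finset.sum_le_sum_of_subset_of_nonneg (Finset.range_mono h)
    fun n _ _ => div_nonneg (coeffSum_nonneg (hP.pow n) N) (by positivity)

/-- The binomial theorem splits `(P + Q) ^ n / n!` into products `P ^ i / i! * Q ^ j / j!` with `i +
j = n`. Non-negativity is used twice: for the coefficient sum of each product, and for enlarging the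
triangle `i + j < K` to a square. -/
theorem coeffSum_truncExp_add_le (N K : ℕ) {P Q : PowerSeries ℝ} (hP : CoeffNonneg P)
    (hQ : CoeffNonneg Q) : coeffSum N (truncExp K (P + Q)) ≤
      coeffSum N (truncExp K P) * coeffSum N (truncExp K Q) := by
  simp only [coeffSum_truncExp]
  refine le_trans (Finset.sum_le_sum fun n _ => ?_) (sum_antidiagonal_le_mul_sum
    (fun n => div_nonneg (coeffSum_nonneg (hP.pow n) N) (by positivity))
    (fun n => div_nonneg (coeffSum_nonneg (hQ.pow n) N) (by positivity)) K)
  rw [(Commute.all P Q).add_pow', map_sum, Finset.sum_div]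
  refine Finset.sum_le_sum fun p hp => ?_
  rw [Finset.HasAntidiagonal.mem_antidiagonal] at hp
  rw [map_nsmul, nsmul_eq_mul, ← hp, Nat.cast_add_choose]
  have h := coeffSum_mul_le (hP.pow p.1) (hQ.pow p.2) N
  have h1 : (p.1 ! : ℝ) ≠ 0 := by positivity
  have h2 : (p.2 ! : ℝ) ≠ 0 := by positivity
  have h3 : ((p.1 + p.2)! : ℝ) ≠ 0 := by positivity
  rw [div_mul_div_comm]
  refine le_trans (le_of_eq ?_) (div_le_div_of_nonneg_right h (by positivity))
  field_simp

/-! ### Comparison with the function `psi` -/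

theorem psi_zero_natCast (u : ℕ) (z : ℝ) :
    psi 0 u z = ∑' n : ℕ, z ^ n / (n ! * (n * u)!) := by
  rw [psi]
  refine tsum_congr fun n => ?_
  rw [← Real.Gamma_nat_eq_factorial (n * u)]
  push_cast
  simp

theorem summable_psi_term (u : ℕ) (z : ℝ) :
    Summable fun n : ℕ => z ^ n / ((n ! : ℝ) * ((n * u)! : ℝ)) := by
  refine (summable_psi_zero u z).congr fun n => ?_
  rw [← Real.Gamma_nat_eq_factorial (n * u)]
  push_cast
  simp

theorem coeffSum_truncExp_tailSeries_le (N K : ℕ) :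
    coeffSum N (truncExp K (tailSeries N)) ≤ psi 0 1 (truncZeta N 2 * N) := by
  have hz : 0 ≤ truncZeta N 2 * N := mul_nonneg (truncZeta_nonneg N 2) (Nat.cast_nonneg N)
  have hpsi := psi_zero_natCast 1 (truncZeta N 2 * N)
  rw [Nat.cast_one] at hpsi
  rw [hpsi, coeffSum_truncExp]
  refine le_trans (Finset.sum_le_sum fun n _ => ?_) ((summable_psi_term 1 _).sum_le_tsum
    (Finset.range K) fun n _ => div_nonneg (pow_nonneg hz n) (by positivity))
  refine (div_le_div_of_nonneg_right (coeffSum_tailSeries_pow_le N n N) (by positivity)).trans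
    (le_of_eq ?_)
  rw [mul_one, mul_pow]
  field_simp

theorem coeffSum_truncExp_tailSqSeries_le (N K : ℕ) :
    coeffSum N (truncExp K (tailSqSeries N)) ≤ psi 0 2 (truncZeta N 3 * (N : ℝ) ^ 2) := by
  have hz : 0 ≤ truncZeta N 3 * (N : ℝ) ^ 2 := mul_nonneg (truncZeta_nonneg N 3) (by positivity)
  have hpsi := psi_zero_natCast 2 (truncZeta N 3 * (N : ℝ) ^ 2)
  rw [Nat.cast_ofNat] at hpsi
  rw [hpsi, coeffSum_truncExp]
  refine le_trans (Finset.sum_le_sum fun n _ => ?_) ((summable_psi_term 2 _).sum_le_tsum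
    (Finset.range K) fun n _ => div_nonneg (pow_nonneg hz n) (by positivity))
  refine (div_le_div_of_nonneg_right (coeffSum_tailSqSeries_pow_le N n N) (by positivity)).trans
    (le_of_eq ?_)
  rw [mul_comm 2 n, mul_pow, ← pow_mul, mul_comm 2 n]
  field_simp

theorem psi_two_le_of_forall_truncExp_le {N : ℕ} {c : ℝ}
    (h : ∀ K, coeffSum N (truncExp K (geomSqSeries N)) ≤ c) :
    psi 0 2 (truncZeta N 3 * (N : ℝ) ^ 2) ≤ c := by
  have hz : 0 ≤ truncZeta N 3 * (N : ℝ) ^ 2 := mul_nonneg (truncZeta_nonneg N 3) (by positivity)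
  have hpsi := psi_zero_natCast 2 (truncZeta N 3 * (N : ℝ) ^ 2)
  rw [Nat.cast_ofNat] at hpsi
  rw [hpsi]
  refine Real.tsum_le_of_sum_range_le (fun n => div_nonneg (pow_nonneg hz n) (by positivity))
    fun K => le_trans ?_ (h K)
  rw [coeffSum_truncExp]
  refine Finset.sum_le_sum fun n _ => ?_
  refine le_trans (le_of_eq ?_) (div_le_div_of_nonneg_right (le_coeffSum_geomSqSeries_pow N n N)
    (by positivity))
  rw [mul_comm 2 n, mul_pow, ← pow_mul, mul_comm 2 n]
  field_simp

theorem coeffSum_truncExp_C_le (N K : ℕ) {c : ℝ} (hc : 0 ≤ c) :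
    coeffSum N (truncExp K (PowerSeries.C c)) ≤ Real.exp c := by
  rw [coeffSum_truncExp]
  refine le_trans (le_of_eq (Finset.sum_congr rfl fun n _ => ?_)) (Real.sum_le_exp_of_nonneg hc K)
  rw [← map_pow, ← mul_one (PowerSeries.C (c ^ n)), ← PowerSeries.smul_eq_C_mul, map_smul,
    coeffSum_one, smul_eq_mul, mul_one]

theorem exp_sum_one_div_le {N : ℕ} (hN : 0 < N) :
    Real.exp (∑ m ∈ Finset.Icc 1 N, 1 / (m : ℝ)) ≤ Real.exp 1 * N := by
  have h := harmonic_le_one_add_log N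
  rw [harmonic_eq_sum_Icc] at h
  push_cast at h
  have hN' : (0 : ℝ) < N := by exact_mod_cast hN
  calc Real.exp (∑ m ∈ Finset.Icc 1 N, 1 / (m : ℝ)) ≤ Real.exp (1 + Real.log N) := by
        simpa only [one_div, Real.exp_le_exp] using h
    _ = Real.exp 1 * N := by rw [Real.exp_add, Real.exp_log hN']

theorem sum_PL_eq {N K : ℕ} (hK : N < K) :
    ∑ n ∈ Finset.range (N + 1), (PL n : ℝ) = coeffSum N (truncExp K (logSeries N)) := by
  rw [coeffSum_apply]
  refine Finset.sum_congr rfl fun n hn => ?_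
  have hn : n ≤ N := Nat.lt_succ_iff.1 (Finset.mem_range.1 hn)
  rw [PL_eq_coeff hn, coeff_macMahonProd_eq hK n hn]

/-- Truncating the exponential after its constant term suffices. The positivity allows division by
this value in the lower bound. -/
theorem one_le_psi_one (N : ℕ) : 1 ≤ psi 0 1 (truncZeta N 2 * N) := by
  refine le_trans (le_of_eq ?_) (coeffSum_truncExp_tailSeries_le N 1)
  simp [truncExp, coeffSum_one]

theorem mainTheorem6 (N : ℕ) (hN : 0 < N) :
    Real.exp (-1) * (N : ℝ)⁻¹ * psi 0 2 (truncZeta N 3 * (N : ℝ) ^ 2) *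
        (psi 0 1 (truncZeta N 2 * (N : ℝ)))⁻¹ ≤ ∑ n ∈ Finset.range (N + 1), (PL n : ℝ) ∧
      ∑ n ∈ Finset.range (N + 1), (PL n : ℝ) ≤
        psi 0 2 (truncZeta N 3 * (N : ℝ) ^ 2) * psi 0 1 (truncZeta N 2 * (N : ℝ)) := by

  have hpsi := one_le_psi_one N
  have hsum := sum_PL_eq (Nat.lt_succ_self N)
  constructor
  · have hS : 0 ≤ ∑ n ∈ Finset.range (N + 1), (PL n : ℝ) := by positivity
    have hN' : (0 : ℝ) < N := by exact_mod_cast hN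
    have hH : 0 ≤ ∑ m ∈ Finset.Icc 1 N, 1 / (m : ℝ) := by positivity
    have key : psi 0 2 (truncZeta N 3 * (N : ℝ) ^ 2) ≤
        (∑ n ∈ Finset.range (N + 1), (PL n : ℝ)) *
          (psi 0 1 (truncZeta N 2 * (N : ℝ)) * (Real.exp 1 * N)) := by
      refine psi_two_le_of_forall_truncExp_le fun K => ?_
      have hG : coeffSum N (truncExp K (logSeries N)) ≤
          ∑ n ∈ Finset.range (N + 1), (PL n : ℝ) := by
        -- The exponential computes the counts only when truncated beyond `N`; truncating at `max N
        -- K + 1` achieves this and dominates the truncation at `K`.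
        rw [sum_PL_eq (Nat.lt_succ_of_le (le_max_left N K))]
        exact coeffSum_truncExp_mono N (coeffNonneg_logSeries N)
          ((le_max_right N K).trans (Nat.le_succ _))
      have hB := coeffNonneg_tailSeries N
      have hC := coeffNonneg_C hH
      -- The exponent splits into the logarithm, `∑ u / m` and the harmonic number, bounded
      -- respectively by the counts, `psi 0 1` and `e N`.
      rw [geomSqSeries_eq]
      refine (coeffSum_truncExp_add_le N K (coeffNonneg_logSeries N) (hB.add hC)).trans ?_
      refine mul_le_mul hG ?_ (coeffSum_truncExp_nonneg N K (hB.add hC)) hS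
      refine (coeffSum_truncExp_add_le N K hB hC).trans ?_
      exact mul_le_mul (coeffSum_truncExp_tailSeries_le N K)
        ((coeffSum_truncExp_C_le N K hH).trans (exp_sum_one_div_le hN))
        (coeffSum_truncExp_nonneg N K hC) (zero_le_one.trans hpsi)
    have hpsi0 : 0 < psi 0 1 (truncZeta N 2 * (N : ℝ)) := zero_lt_one.trans_le hpsi
    calc Real.exp (-1) * (N : ℝ)⁻¹ * psi 0 2 (truncZeta N 3 * (N : ℝ) ^ 2) *
          (psi 0 1 (truncZeta N 2 * (N : ℝ)))⁻¹
        = psi 0 2 (truncZeta N 3 * (N : ℝ) ^ 2) /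
            (psi 0 1 (truncZeta N 2 * (N : ℝ)) * (Real.exp 1 * N)) := by
          rw [Real.exp_neg]
          field_simp
      _ ≤ _ := (div_le_iff₀ (by positivity)).2 key
  · rw [hsum, logSeries_eq]
    refine (coeffSum_truncExp_add_le N _ (coeffNonneg_tailSqSeries N)
      (coeffNonneg_tailSeries N)).trans ?_
    have hA := coeffSum_truncExp_tailSqSeries_le N (N + 1)
    exact mul_le_mul hA (coeffSum_truncExp_tailSeries_le N _)
      (coeffSum_truncExp_nonneg N _ (coeffNonneg_tailSeries N))
      ((coeffSum_truncExp_nonneg N _ (coeffNonneg_tailSqSeries N)).trans hA)
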